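/- Let $f_n := (q^n;q^n)_\infty=\prod_{j\ge 1}(1-q^{nj})$ for $n\ge1$, viewed as a formal power series in $q$ (equivalently, for $|q|<1$). For integers $\ell>1$, $m>1$ and $k\ge 1$ define the coefficients $\delta_{m;k}(n)$ and $\delta_{\ell,m;k}(n)$ by $$\sum_{n=0}^{\infty}\delta_{m;k}(n)q^n=\frac{f_1^k}{f_m^k},\qquad \sum_{n=0}^{\infty}\delta_{\ell,m;k}(n)q^n=\frac{f_1^k f_{\ell}^k}{f_m^k f_{\ell m}^k},$$ and let $\delta'_{m;k}(n)$ and $\delta'_{\ell,m;k}(n)$ denote the coefficients of the reciprocal series, that is, $$\sum_{n=0}^{\infty}\delta'_{m;k}(n)q^n=\frac{f_m^k}{f_1^k},\qquad \sum_{n=0}^{\infty}\delta'_{\ell,m;k}(n)q^n=\frac{f_m^k f_{\ell m}^k}{f_1^k f_{\ell}^k}.$$ Then, for all integers $n\ge 0$: 1. $\delta_{3;3}(3n+1)=-3\,\delta'_{3;3}(n)$; 2. $\delta_{3;6}(3n+2)=9\,\delta'_{3;6}(n)$; 3. $\delta_{5;2}(5n+2)=-\delta'_{5;2}(n)$; 4.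 $\delta_{5;3}(5n+3)=5\,\delta'_{5;3}(n)$; 5. $\delta_{5;4}(5n+4)=-5\,\delta'_{5;4}(n)$; 6. $\delta_{5;8}(5n+8)=-125\,\delta'_{5;8}(n)$; 7. $\delta_{7;2}(7n+4)=\delta'_{7;2}(n)$; 8. $\delta_{7;3}(7n+6)=-7\,\delta'_{7;3}(n)$; 9. $\delta_{7;6}(7n+12)=49\,\delta'_{7;6}(n)$; 10. $\delta_{11;2}(11n+10)=\delta'_{11;2}(n)$; 11. $\delta_{2,3;1}(3n+1)=-\delta'_{2,3;1}(n)$; 12. $\delta_{2,3;2}(3n+2)=-3\,\delta'_{2,3;2}(n)$; 13. $\delta_{2,3;5}(3n+5)=-81\,\delta'_{2,3;5}(n)$; 14. $\delta_{2,5;1}(5n+3)=\delta'_{2,5;1}(n)$; 15. $\delta_{2,5;3}(5n+9)=25\,\delta'_{2,5;3}(n)$; 16. $\delta_{3,5;1}(5n+4)=\delta'_{3,5;1}(n)$; 17. $\delta_{3,5;2}(5n+8)=-5\,\delta'_{3,5;2}(n)$; 18. $\delta_{3,5;3}(5n+12)=25\,\delta'_{3,5;3}(n)$; 19. $\delta_{2,7;1}(7n+6)=\delta'_{2,7;1}(n)$;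 20. $\delta_{4,7;1}(7n+10)=\delta'_{4,7;1}(n)$; 21. $\delta_{3,11;1}(11n+20)=\delta'_{3,11;1}(n)$; 22. $\delta_{4,11;1}(11n+25)=\delta'_{4,11;1}(n)$. -/

import Mathlib

namespace MatchingCoeff

noncomputable section

open PowerSeries
open scoped PowerSeries.WithPiTopology

/-- `(a; q)_∞ = ∏_{j ≥ 0} (1 - a q ^ j)`, for formal power series `a` and `q`; the infinite product
is taken coefficientwise (product topology on the coefficients). -/
def qPochhammerInf (a q : ℚ⟦X⟧) : ℚ⟦X⟧ := ∏' j : ℕ, (1 - a * q ^ j)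

/-- `f_n = (q ^ n; q ^ n)_∞`, as a formal power series in `q = X`. -/
def f (n : ℕ) : ℚ⟦X⟧ := qPochhammerInf (X ^ n) (X ^ n)

/-- The generating series `f_1 ^ k / f_m ^ k` of `δ_{m;k}`. -/
def deltaSeries (m k : ℕ) : ℚ⟦X⟧ := f 1 ^ k * (f m ^ k)⁻¹

/-- The generating series `f_1 ^ k f_ℓ ^ k / (f_m ^ k f_{ℓ m} ^ k)` of `δ_{ℓ,m;k}`. -/
def deltaSeries₂ (l m k : ℕ) : ℚ⟦X⟧ := f 1 ^ k * f l ^ k * (f m ^ k * f (l * m) ^ k)⁻¹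

/-- `δ_{m;k}(n)`. -/
def δ (m k n : ℕ) : ℚ := coeff n (deltaSeries m k)

/-- `δ'_{m;k}(n)`: the coefficients of the reciprocal series. -/
def δ' (m k n : ℕ) : ℚ := coeff n (deltaSeries m k)⁻¹

/-- `δ_{ℓ,m;k}(n)`. -/
def δ₂ (l m k n : ℕ) : ℚ := coeff n (deltaSeries₂ l m k)

/-- `δ'_{ℓ,m;k}(n)`: the coefficients of the reciprocal series. -/
def δ₂' (l m k n : ℕ) : ℚ := coeff n (deltaSeries₂ l m k)⁻¹

/-- The product defining `f_n` converges for `n ≥ 1`. -/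
theorem hasProd_f {n : ℕ} (hn : 0 < n) :
    HasProd (fun j : ℕ => (1 : ℚ⟦X⟧) - X ^ n * (X ^ n) ^ j) (f n) := by
  refine Multipliable.hasProd ?_
  simp_rw [sub_eq_add_neg]
  apply PowerSeries.WithPiTopology.multipliable_one_add_of_tendsto_order_atTop_nhds_top
  refine ENat.tendsto_nhds_top_iff_natCast_lt.mpr fun N => Filter.eventually_atTop.mpr ⟨N, ?_⟩
  intro j hj
  rw [order_neg, ← pow_mul, ← pow_add, order_X_pow]
  have : N < n + n * j := by nlinarith
  exact_mod_cast this

/-- For `n ≥ 1` the constant term of `f_n` is `1`, so that `f_n` is invertible. -/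
theorem constantCoeff_f {n : ℕ} (hn : 0 < n) : constantCoeff (f n) = 1 := by
  have h := (hasProd_f hn).map (constantCoeff (R := ℚ))
    (PowerSeries.WithPiTopology.continuous_constantCoeff ℚ)
  refine h.unique ?_
  convert (hasProd_one : HasProd (fun _ : ℕ => (1 : ℚ)) 1) using 2 with j
  simp [hn.ne']

/-- `deltaSeries m k` is the quotient `f_1 ^ k / f_m ^ k`. -/
theorem deltaSeries_mul {m : ℕ} (hm : 0 < m) (k : ℕ) : deltaSeries m k * f m ^ k = f 1 ^ k := by
  rw [deltaSeries, mul_assoc, PowerSeries.inv_mul_cancel, mul_one]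
  simp [constantCoeff_f hm]

/-- `deltaSeries₂ l m k` is the quotient `f_1 ^ k f_ℓ ^ k / (f_m ^ k f_{ℓ m} ^ k)`. -/
theorem deltaSeries₂_mul {l m : ℕ} (hl : 0 < l) (hm : 0 < m) (k : ℕ) :
    deltaSeries₂ l m k * (f m ^ k * f (l * m) ^ k) = f 1 ^ k * f l ^ k := by
  rw [deltaSeries₂, mul_assoc, PowerSeries.inv_mul_cancel, mul_one]
  simp [constantCoeff_f hm, constantCoeff_f (Nat.mul_pos hl hm)]

/-- The reciprocal of `deltaSeries m k` is a genuine reciprocal. -/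
theorem deltaSeries_mul_inv {m : ℕ} (hm : 0 < m) (k : ℕ) :
    deltaSeries m k * (deltaSeries m k)⁻¹ = 1 := by
  apply PowerSeries.mul_inv_cancel
  simp [deltaSeries, constantCoeff_f hm, constantCoeff_f one_pos]

/-- The reciprocal of `deltaSeries₂ l m k` is a genuine reciprocal. -/
theorem deltaSeries₂_mul_inv {l m : ℕ} (hl : 0 < l) (hm : 0 < m) (k : ℕ) :
    deltaSeries₂ l m k * (deltaSeries₂ l m k)⁻¹ = 1 := by
  apply PowerSeries.mul_inv_cancel
  simp [deltaSeries₂, constantCoeff_f hm, constantCoeff_f hl, constantCoeff_f one_pos,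
    constantCoeff_f (Nat.mul_pos hl hm)]

end

end MatchingCoeff

namespace MatchingCoeff

open PowerSeries Filter
open scoped PowerSeries.WithPiTopology

/-! Every quotient in question has the form `F(q) / F(q^m)` with `F = f_1^k` or `F = f_1^k f_ℓ^k`.
The denominator is a series in `q^m`, so extracting the exponents congruent to `r` only affects `F`.
If that component of `F` is `c q^r F(q^(m^2))` (`SelfSimilar`), then dividing out `q^r` and
replacing `q^m` by `q` leaves `c F(q^m) / F(q)`, which is `c` times the reciprocal series
(`SelfSimilar.coeff_eq`). Each item is therefore a self-similarity statement about `F`.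

For unary theta series this is completing the square: if `D e(n) + w^2 = (s n + w)^2`, the class of
`r` singles out the `n` with `m ∣ s n + w`, and rescaling by `m` reproduces the series
(`selfSimilar_of_hasSum`). This covers `f_1` (pentagonal numbers), `f_1^3` (Jacobi), `φ(-q)` and
`ψ(q)`; the expansions come from finite `q`-binomial identities by a limit. For a product of two
such series, the convolution over residue classes collapses to a single term when the attached
binary quadratic form is anisotropic mod `m` (`SelfSimilar.mul_of_anisotropic`). Most items follow
in this way.

In the isotropic cases, polynomial relations between the components take over. Mod 5, the components
`a, b, c` of `f_1` satisfy `ac + b^2 = 0`, because `f_1^3` has no exponents in class 2. Mod 3, `f_1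
f_2 = φ(-q) ψ(q)` and `f_1^3 = φ(-q)^2 ψ(q)` give an analogous relation. The hardest case, `f_1^2
f_3^2` mod 5, needs a relation between the components of `f_1` and `f_3`. It comes from the
self-similarity of `f_3^3 / f_1`, which solves `F = ψ(q^2) f(q^2, q^4) + q F(q^4)`, by eliminating
the unknown components of this quotient. -/

/-! ### Infinite products of formal power series -/

theorem hasProd_qPochhammerInf (α : ℚ⟦X⟧) {q : ℚ⟦X⟧} (hq : X ∣ q) :
    HasProd (fun j : ℕ => 1 - α * q ^ j) (qPochhammerInf α q) := by
  refine Multipliable.hasProd ?_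
  simp_rw [sub_eq_add_neg]
  apply PowerSeries.WithPiTopology.multipliable_one_add_of_tendsto_order_atTop_nhds_top
  refine ENat.tendsto_nhds_top_iff_natCast_lt.mpr fun N => Filter.eventually_atTop.mpr ⟨N + 1, ?_⟩
  intro j hj
  rw [order_neg]
  have h : X ^ j ∣ α * q ^ j := Dvd.dvd.mul_left (pow_dvd_pow_of_dvd hq j) α
  exact lt_of_lt_of_le (by exact_mod_cast hj) (le_order _ j fun i hi => X_pow_dvd_iff.mp h i
    (by exact_mod_cast hi))

/-- The infinite product agrees with its partial products up to the expected order. -/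
theorem X_pow_dvd_qPochhammerInf_sub {α q : ℚ⟦X⟧} (hq : X ∣ q) (N : ℕ) :
    X ^ N ∣ qPochhammerInf α q - ∏ j ∈ Finset.range N, (1 - α * q ^ j) := by
  rw [X_pow_dvd_iff]
  intro d hd
  rw [map_sub, sub_eq_zero]
  have h1 := (hasProd_qPochhammerInf α hq).tendsto_prod_nat
  rw [PowerSeries.WithPiTopology.tendsto_iff_coeff_tendsto] at h1
  refine tendsto_nhds_unique (h1 d) (tendsto_atTop_of_eventually_const (i₀ := N) fun M hM => ?_)
  induction M, hM using Nat.le_induction with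
  | base => rfl
  | succ M hM ih =>
    rw [Finset.prod_range_succ, mul_sub, mul_one, map_sub, ih, sub_eq_self]
    have h : X ^ M ∣ (∏ j ∈ Finset.range M, (1 - α * q ^ j)) * (α * q ^ M) :=
      ((pow_dvd_pow_of_dvd hq M).mul_left α).mul_left _
    exact X_pow_dvd_iff.mp h d (by omega)

theorem prod_range_mul' {M : Type*} [CommMonoid M] (g : ℕ → M) (m N : ℕ) :
    ∏ j ∈ Finset.range (m * N), g j =
      ∏ r ∈ Finset.range m, ∏ j ∈ Finset.range N, g (m * j + r) := by
  rw [Finset.prod_comm]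
  induction N with
  | zero => simp
  | succ N ih => rw [mul_add, mul_one, Finset.prod_range_add, ih, Finset.prod_range_succ]

theorem qPochhammerInf_eq_prod (α : ℚ⟦X⟧) {q : ℚ⟦X⟧} (hq : X ∣ q) {m : ℕ} (hm : m ≠ 0) :
    qPochhammerInf α q = ∏ r ∈ Finset.range m, qPochhammerInf (α * q ^ r) (q ^ m) := by
  have h1 := (hasProd_qPochhammerInf α hq).tendsto_prod_nat
  have h2 : Tendsto (fun N : ℕ => m * N) atTop atTop :=
    tendsto_id.const_mul_atTop' (Nat.pos_of_ne_zero hm)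
  have h3 := h1.comp h2
  refine tendsto_nhds_unique h3 ?_
  have h4 := tendsto_finsetProd (Finset.range m) fun r _ =>
    (hasProd_qPochhammerInf (α * q ^ r) (dvd_pow hq hm)).tendsto_prod_nat
  refine h4.congr fun N => ?_
  rw [Function.comp, prod_range_mul']
  refine Finset.prod_congr rfl fun r _ => Finset.prod_congr rfl fun j _ => ?_
  ring

theorem qPochhammerInf_mul_neg (α : ℚ⟦X⟧) {q : ℚ⟦X⟧} (hq : X ∣ q) :
    qPochhammerInf α q * qPochhammerInf (-α) q = qPochhammerInf (α ^ 2) (q ^ 2) := by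
  refine ((hasProd_qPochhammerInf α hq).mul (hasProd_qPochhammerInf (-α) hq)).unique ?_
  convert hasProd_qPochhammerInf (α ^ 2) (dvd_pow hq two_ne_zero) using 2 with j
  ring

theorem continuous_expand {p : ℕ} (hp : p ≠ 0) : Continuous (expand p hp : ℚ⟦X⟧ → ℚ⟦X⟧) := by
  refine continuous_iff_continuousAt.mpr fun F => ?_
  rw [ContinuousAt, PowerSeries.WithPiTopology.tendsto_iff_coeff_tendsto]
  intro d
  simp only [coeff_expand]
  split_ifs
  · exact ((PowerSeries.WithPiTopology.continuous_coeff ℚ _).tendsto F)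
  · exact tendsto_const_nhds

theorem expand_qPochhammerInf {p : ℕ} (hp : p ≠ 0) (α : ℚ⟦X⟧) {q : ℚ⟦X⟧} (hq : X ∣ q) :
    expand p hp (qPochhammerInf α q) = qPochhammerInf (expand p hp α) (expand p hp q) := by
  have h := (hasProd_qPochhammerInf α hq).map (expand p hp) (continuous_expand hp)
  refine h.unique ?_
  have hq' : X ∣ expand p hp q := by
    obtain ⟨g, rfl⟩ := hq
    rw [map_mul, expand_X]
    exact (dvd_pow_self X hp).mul_right _
  convert hasProd_qPochhammerInf (expand p hp α) hq' using 2 with j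
  simp

theorem expand_f {p : ℕ} (hp : p ≠ 0) {n : ℕ} (hn : n ≠ 0) : expand p hp (f n) = f (p * n) := by
  rw [f, expand_qPochhammerInf _ _ (dvd_pow_self X hn), f]
  simp [pow_mul]

theorem f_ne_zero {n : ℕ} (hn : 0 < n) : f n ≠ 0 := fun h => by
  simpa [h] using constantCoeff_f hn

/-! ### Gaussian binomials and the finite `q`-binomial theorem -/

/-- The Gaussian binomial coefficients. -/
def qBinom {R : Type*} [CommRing R] (q : R) : ℕ → ℕ → R
  | _, 0 => 1
  | 0, _ + 1 => 0
  | n + 1, k + 1 => qBinom q n k + q ^ (k + 1) * qBinom q n (k + 1)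

section QBinom

variable {R : Type*} [CommRing R] (q : R)

@[simp] theorem qBinom_zero_right (n : ℕ) : qBinom q n 0 = 1 := by cases n <;> rfl

theorem qBinom_succ_succ (n k : ℕ) :
    qBinom q (n + 1) (k + 1) = qBinom q n k + q ^ (k + 1) * qBinom q n (k + 1) := rfl

theorem qBinom_eq_zero_of_lt {n k : ℕ} (h : n < k) : qBinom q n k = 0 := by
  induction n generalizing k with
  | zero => obtain ⟨k, rfl⟩ := Nat.exists_eq_succ_of_ne_zero (by omega : k ≠ 0); rfl
  | succ n ih =>
    obtain ⟨k, rfl⟩ := Nat.exists_eq_succ_of_ne_zero (by omega : k ≠ 0)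
    rw [Nat.succ_eq_add_one, qBinom_succ_succ, ih (by omega), ih (by omega)]
    simp

theorem qBinom_self (n : ℕ) : qBinom q n n = 1 := by
  induction n with
  | zero => rfl
  | succ n ih => rw [qBinom_succ_succ, ih, qBinom_eq_zero_of_lt q (Nat.lt_succ_self n)]; simp

/-- Division-free form of the quotient formula for Gaussian binomials. The Pascal recursion closes
up because `(1 - q^(k+1)) + q^(k+1) (1 - q^(j+1)) = 1 - q^(k+j+2)`. -/
theorem qBinom_mul_prod (k j : ℕ) :
    qBinom q (k + j) k * (∏ i ∈ Finset.range k, (1 - q * q ^ i)) *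
      (∏ i ∈ Finset.range j, (1 - q * q ^ i)) = ∏ i ∈ Finset.range (k + j), (1 - q * q ^ i) := by
  obtain ⟨n, hn⟩ : ∃ n, k + j = n := ⟨_, rfl⟩
  induction n generalizing k j with
  | zero =>
    obtain ⟨rfl, rfl⟩ : k = 0 ∧ j = 0 := by omega
    simp
  | succ n ih =>
    rcases k with _ | k
    · simp
    rcases j with _ | j
    · simp [qBinom_self]
    have h1 := ih k (j + 1) (by omega)
    have h2 := ih (k + 1) j (by omega)
    rw [show k + 1 + (j + 1) = (k + (j + 1)) + 1 by ring, qBinom_succ_succ,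
      Finset.prod_range_succ _ (k + (j + 1)), Finset.prod_range_succ _ k,
      Finset.prod_range_succ _ j]
    rw [show k + 1 + j = k + (j + 1) by ring, Finset.prod_range_succ _ k] at h2
    rw [Finset.prod_range_succ _ j] at h1
    linear_combination (1 - q * q ^ k) * h1 + q ^ (k + 1) * (1 - q * q ^ j) * h2

/-- The (homogeneous) `q`-binomial theorem. -/
theorem prod_add_mul_pow (x y : R) (M : ℕ) :
    ∏ i ∈ Finset.range M, (y + x * q ^ i) = ∑ k ∈ Finset.range (M + 1),
      qBinom q M k * q ^ (k.choose 2) * x ^ k * y ^ (M - k) := by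
  induction M generalizing x with
  | zero => simp
  | succ M ih =>
    have h1 : ∏ i ∈ Finset.range M, (y + x * q ^ (i + 1)) =
        ∏ i ∈ Finset.range M, (y + (x * q) * q ^ i) :=
      Finset.prod_congr rfl fun i _ => by ring
    rw [Finset.prod_range_succ', h1, ih, pow_zero, mul_one, mul_add, Finset.sum_range_succ' _ (M + 1)]
    have h2 : (∑ k ∈ Finset.range (M + 1), qBinom q M k * q ^ (k.choose 2) * (x * q) ^ k *
        y ^ (M - k)) * y = ∑ k ∈ Finset.range (M + 1), qBinom q M (k + 1) *
          q ^ ((k + 1).choose 2 + (k + 1)) * x ^ (k + 1) * y ^ (M - k) + y ^ (M + 1) := by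
      rw [Finset.sum_range_succ', add_mul, Finset.sum_range_succ _ M,
        qBinom_eq_zero_of_lt q (Nat.lt_succ_self M), Finset.sum_mul]
      simp only [zero_mul, add_zero]
      congr 1
      · refine Finset.sum_congr rfl fun k hk => ?_
        have hk' : M - k = M - (k + 1) + 1 := by have := Finset.mem_range.mp hk; omega
        rw [hk']
        ring
      · simp [pow_succ]
    rw [h2, Finset.sum_mul, add_right_comm, ← Finset.sum_add_distrib]
    congr 1
    · refine Finset.sum_congr rfl fun k _ => ?_
      rw [qBinom_succ_succ, Nat.succ_sub_succ, Nat.choose_succ_succ' k 1, Nat.choose_one_right]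
      ring
    · simp

theorem map_qBinom {S : Type*} [CommRing S] (φ : R →+* S) (n k : ℕ) :
    φ (qBinom q n k) = qBinom (φ q) n k := by
  induction n generalizing k with
  | zero => cases k <;> simp [qBinom]
  | succ n ih => cases k <;> simp [qBinom, ih]

theorem prod_pow_range (N : ℕ) : ∏ i ∈ Finset.range N, q ^ i = q ^ (N.choose 2) := by
  rw [Finset.prod_pow_eq_pow_sum, Finset.sum_range_id, Nat.choose_two_right]

end QBinom

/-! ### The triple product and Jacobi's identity as limits of finite identities -/

theorem two_mul_choose_two (k : ℕ) : 2 * (k.choose 2 : ℤ) = k * (k - 1) := by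
  induction k with
  | zero => simp
  | succ k ih =>
    rw [Nat.choose_succ_succ' k 1, Nat.choose_one_right]
    push_cast
    linear_combination ih

theorem isUnit_f {b : ℕ} (hb : 0 < b) : IsUnit (f b) := by
  rw [isUnit_iff_constantCoeff, constantCoeff_f hb]
  exact isUnit_one

/-- When both lower parameters grow, all three products in the quotient formula tend to `f b`, so
the Gaussian binomial tends to `1 / f b`. -/
theorem X_pow_dvd_f_mul_qBinom_sub_one {b : ℕ} (hb : 0 < b) {d k j : ℕ} (hk : d ≤ k) (hj : d ≤ j) :
    (X : ℚ⟦X⟧) ^ d ∣ f b * qBinom (X ^ b) (k + j) k - 1 := by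
  have hX : (X : ℚ⟦X⟧) ∣ X ^ b := dvd_pow_self X hb.ne'
  have key (n : ℕ) (hn : d ≤ n) : (X : ℚ⟦X⟧) ^ d ∣
      f b - ∏ i ∈ Finset.range n, (1 - X ^ b * (X ^ b) ^ i) :=
    (pow_dvd_pow X hn).trans (X_pow_dvd_qPochhammerInf_sub hX n)
  have h := qBinom_mul_prod ((X : ℚ⟦X⟧) ^ b) k j
  obtain ⟨u, hu⟩ := key k hk
  obtain ⟨v, hv⟩ := key j hj
  obtain ⟨w, hw⟩ := key (k + j) (by omega)
  rw [sub_eq_iff_eq_add'] at hu hv hw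
  refine (isUnit_f hb).dvd_mul_left.mp ⟨qBinom (X ^ b) (k + j) k * (u * f b +
    (∏ i ∈ Finset.range k, (1 - (X : ℚ⟦X⟧) ^ b * (X ^ b) ^ i)) * v) - w, ?_⟩
  linear_combination (qBinom ((X : ℚ⟦X⟧) ^ b) (k + j) k * f b) * hu +
    (qBinom ((X : ℚ⟦X⟧) ^ b) (k + j) k *
      (∏ i ∈ Finset.range k, (1 - (X : ℚ⟦X⟧) ^ b * (X ^ b) ^ i))) * hv - hw + h

/-- Passage to the limit in a finite theta identity with Gaussian binomial coefficients. -/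
theorem hasSum_of_qBinom {b : ℕ} (hb : 0 < b) {F : ℚ⟦X⟧} {c : ℤ → ℚ} {e : ℤ → ℕ}
    (he : ∀ n, |n| ≤ e n + 1) (s : ℕ)
    (h : ∀ N : ℕ, X ^ N ∣ F - f b * ∑ k ∈ Finset.range (2 * N + s + 1),
      qBinom (X ^ b) (2 * N + s) k * (C (c (k - N - s)) * X ^ e (k - N - s))) :
    HasSum (fun n : ℤ => C (c n) * X ^ e n) F := by
  rw [PowerSeries.WithPiTopology.hasSum_iff_hasSum_coeff]
  intro d
  -- A term with exponent at most `d` has index `|n| ≤ d + 1`. With this `N`, both `k = n + N + s`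
  -- and `2N + s - k = N - n` are then at least `d + 1`, so its Gaussian binomial is already `1 / f
  -- b` up to order `d + 1`.
  obtain ⟨N, hN⟩ : ∃ N, N = 2 * d + 2 := ⟨_, rfl⟩
  have h1 := X_pow_dvd_iff.mp (h N) d (by omega)
  rw [map_sub, sub_eq_zero, Finset.mul_sum, map_sum] at h1
  let g : ℕ ↪ ℤ := ⟨fun k => (k : ℤ) - N - s, fun x y hxy => by simpa using hxy⟩
  have h2 : coeff d F = ∑ n ∈ (Finset.range (2 * N + s + 1)).map g,
      coeff d (C (c n) * X ^ e n) := by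
    rw [h1, Finset.sum_map]
    refine Finset.sum_congr rfl fun k hk => ?_
    have hk' := Finset.mem_range.mp hk
    change _ = coeff d (C (c (k - N - s)) * X ^ e (k - N - s))
    rw [← mul_assoc, ← sub_eq_zero, ← map_sub, ← sub_one_mul]
    by_cases hd : d < e (k - N - s)
    · have : (X : ℚ⟦X⟧) ^ (d + 1) ∣ (f b * qBinom (X ^ b) (2 * N + s) k - 1) *
          (C (c (k - N - s)) * X ^ e (k - N - s)) :=
        ((pow_dvd_pow X hd).mul_left _).mul_left _
      exact X_pow_dvd_iff.mp this d (by omega)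
    · have h3 := he (k - N - s)
      rw [abs_le] at h3
      obtain ⟨j, hj⟩ : ∃ j, 2 * N + s = k + j := ⟨2 * N + s - k, by omega⟩
      have : (X : ℚ⟦X⟧) ^ (d + 1) ∣ f b * qBinom (X ^ b) (2 * N + s) k - 1 := by
        rw [hj]
        exact X_pow_dvd_f_mul_qBinom_sub_one hb (by omega) (by omega)
      exact X_pow_dvd_iff.mp (this.mul_right _) d (by omega)
  rw [h2]
  refine hasSum_sum_of_ne_finset_zero fun n hn => ?_
  rw [coeff_C_mul, coeff_X_pow, if_neg, mul_zero]
  rintro rfl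
  apply hn
  have h3 := he n
  rw [abs_le] at h3
  rw [Finset.mem_map]
  refine ⟨(n + N + s).toNat, Finset.mem_range.mpr (by omega), ?_⟩
  change ((n + N + s).toNat : ℤ) - N - s = n
  omega

/-- The finite form of the Jacobi triple product. -/
theorem finite_tripleProduct {ε : ℚ} (hε : ε * ε = 1) {a b : ℕ} {e : ℤ → ℕ}
    (he : ∀ n : ℤ, 2 * (e n : ℤ) = a * (n * (n + 1)) + b * (n * (n - 1))) (N : ℕ) :
    (∏ j ∈ Finset.range N, (1 + C ε * X ^ a * (X ^ (a + b)) ^ j)) *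
      (∏ j ∈ Finset.range N, (1 + C ε * X ^ b * (X ^ (a + b)) ^ j)) =
    ∑ k ∈ Finset.range (2 * N + 1), qBinom ((X : ℚ⟦X⟧) ^ (a + b)) (2 * N) k *
      (C (ε ^ ((k : ℤ) - N)) * X ^ e (k - N)) := by
  have hε0 : ε ≠ 0 := left_ne_zero_of_mul_eq_one hε
  have hC : C ε * C ε = (1 : ℚ⟦X⟧) := by rw [← map_mul, hε, map_one]
  -- The choice `y = q^((a+b)N)` centres the product: the first `N` factors, read backwards, give
  -- the product in `ε q^b`, using `ε^2 = 1`, and the last `N` give the product in `ε q^a`.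
  have key := prod_add_mul_pow ((X : ℚ⟦X⟧) ^ (a + b)) (C ε * X ^ a) ((X ^ (a + b)) ^ N) (2 * N)
  have h1 : ∏ i ∈ Finset.range N, (((X : ℚ⟦X⟧) ^ (a + b)) ^ N + C ε * X ^ a * (X ^ (a + b)) ^ i) =
      (C ε * X ^ a) ^ N * (X ^ (a + b)) ^ (N.choose 2) *
        ∏ j ∈ Finset.range N, (1 + C ε * X ^ b * (X ^ (a + b)) ^ j) := by
    have hc : (C ε * (X : ℚ⟦X⟧) ^ a) ^ N = ∏ _i ∈ Finset.range N, C ε * X ^ a := by simp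
    rw [← prod_pow_range, ← Finset.prod_range_reflect (fun i => ((X : ℚ⟦X⟧) ^ (a + b)) ^ i),
      ← Finset.prod_range_reflect, hc,
      ← Finset.prod_mul_distrib, ← Finset.prod_mul_distrib]
    refine Finset.prod_congr rfl fun i hi => ?_
    have hi' := Finset.mem_range.mp hi
    have h : ((X : ℚ⟦X⟧) ^ (a + b)) ^ N = X ^ a * X ^ b * (X ^ (a + b)) ^ (N - 1 - i) *
        (X ^ (a + b)) ^ i := by
      rw [← pow_add X a b, mul_assoc, ← pow_add, ← pow_succ']
      congr 1
      omega
    rw [h]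
    linear_combination (-(X ^ a * X ^ b * (X ^ (a + b)) ^ (N - 1 - i) *
        (X ^ (a + b)) ^ i) : ℚ⟦X⟧) * hC
  have h2 : ∏ j ∈ Finset.range N,
      (((X : ℚ⟦X⟧) ^ (a + b)) ^ N + C ε * X ^ a * (X ^ (a + b)) ^ (N + j)) =
      ((X ^ (a + b)) ^ N) ^ N * ∏ j ∈ Finset.range N, (1 + C ε * X ^ a * (X ^ (a + b)) ^ j) := by
    have hc : (((X : ℚ⟦X⟧) ^ (a + b)) ^ N) ^ N =
        ∏ _i ∈ Finset.range N, ((X : ℚ⟦X⟧) ^ (a + b)) ^ N := by simp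
    rw [hc, ← Finset.prod_mul_distrib]
    refine Finset.prod_congr rfl fun i _ => ?_
    ring
  rw [two_mul N, Finset.prod_range_add, h1, h2, ← two_mul] at key
  have hne : (C ε * (X : ℚ⟦X⟧) ^ a) ^ N * (X ^ (a + b)) ^ (N.choose 2) * ((X ^ (a + b)) ^ N) ^ N ≠ 0 := by
    have : (C ε : ℚ⟦X⟧) ≠ 0 := left_ne_zero_of_mul_eq_one hC
    have hX : (X : ℚ⟦X⟧) ≠ 0 := X_ne_zero
    positivity
  refine mul_left_cancel₀ hne (Eq.trans (by ring) (key.trans ?_))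
  rw [Finset.mul_sum]
  refine Finset.sum_congr rfl fun k hk => ?_
  have hk' := Finset.mem_range.mp hk
  have h3 : (C ε : ℚ⟦X⟧) ^ k = C ε ^ N * C (ε ^ ((k : ℤ) - N)) := by
    rw [← map_pow, ← map_pow, ← map_mul]
    congr 1
    rw [← zpow_natCast, ← zpow_natCast, ← zpow_add₀ hε0]
    congr 1
    ring
  have h4 : (a + b) * k.choose 2 + a * k + (a + b) * N * (2 * N - k) =
      a * N + (a + b) * N.choose 2 + (a + b) * N * N + e (k - N) := by
    have h5 := he (k - N)
    have c1 := two_mul_choose_two k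
    have c2 := two_mul_choose_two N
    have c3 : ((2 * N - k : ℕ) : ℤ) = 2 * N - k := by omega
    zify
    rw [c3]
    refine mul_left_cancel₀ (two_ne_zero (α := ℤ)) ?_
    linear_combination ((a : ℤ) + b) * c1 - ((a : ℤ) + b) * c2 - h5
  have h7 : (X : ℚ⟦X⟧) ^ ((a + b) * k.choose 2 + a * k + (a + b) * N * (2 * N - k)) =
    X ^ (a * N + (a + b) * N.choose 2 + (a + b) * N * N + e (k - N)) := by rw [h4]
  simp only [pow_add, pow_mul] at h7
  simp only [mul_pow, h3, pow_add] at h7 ⊢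
  linear_combination (qBinom ((X : ℚ⟦X⟧) ^ a * X ^ b) (2 * N) k * C ε ^ N *
    C (ε ^ ((k : ℤ) - N))) * h7

/-- The **Jacobi triple product** for formal power series. -/
theorem hasSum_tripleProduct {ε : ℚ} (hε : ε * ε = 1) {a b : ℕ} (ha : 0 < a) (hb : 0 < b)
    {e : ℤ → ℕ} (he : ∀ n : ℤ, 2 * (e n : ℤ) = a * (n * (n + 1)) + b * (n * (n - 1))) :
    HasSum (fun n : ℤ => C (ε ^ n) * X ^ e n)
      (f (a + b) * (qPochhammerInf (-(C ε * X ^ a)) (X ^ (a + b)) *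
        qPochhammerInf (-(C ε * X ^ b)) (X ^ (a + b)))) := by
  refine hasSum_of_qBinom (b := a + b) (by omega) (fun n => ?_) 0 fun N => ?_
  · have h := he n
    have h1 : (1 : ℤ) ≤ a := by exact_mod_cast ha
    have h2 : (1 : ℤ) ≤ b := by exact_mod_cast hb
    have h3 : 0 ≤ n * (n + 1) := by rcases le_or_gt 0 n with h | h <;> nlinarith
    have h4 : 0 ≤ n * (n - 1) := by rcases le_or_gt n 0 with h | h <;> nlinarith
    rw [abs_le]
    constructor <;> nlinarith
  · simp only [add_zero, Nat.cast_zero, sub_zero]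
    rw [← finite_tripleProduct hε he, ← mul_sub]
    have hX : (X : ℚ⟦X⟧) ∣ X ^ (a + b) := dvd_pow_self X (by omega)
    obtain ⟨u, hu⟩ := X_pow_dvd_qPochhammerInf_sub (α := -(C ε * X ^ a)) hX N
    obtain ⟨v, hv⟩ := X_pow_dvd_qPochhammerInf_sub (α := -(C ε * X ^ b)) hX N
    simp only [neg_mul, sub_neg_eq_add] at hu hv
    rw [sub_eq_iff_eq_add] at hu hv
    rw [hu, hv]
    refine Dvd.dvd.mul_left ⟨X ^ N * (u * v) + u * (∏ j ∈ Finset.range N,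
      (1 + C ε * X ^ b * (X ^ (a + b)) ^ j)) + v * (∏ j ∈ Finset.range N,
      (1 + C ε * X ^ a * (X ^ (a + b)) ^ j)), ?_⟩ _
    ring

/-- The finite form of Jacobi's identity for the cube of Euler's product. -/
theorem finite_jacobi {e : ℤ → ℕ} (he : ∀ n : ℤ, 2 * (e n : ℤ) = n * (n + 1)) (N : ℕ) :
    (∏ j ∈ Finset.range N, (1 - (X : ℚ⟦X⟧) * X ^ j)) ^ 2 =
    ∑ k ∈ Finset.range (2 * N + 1 + 1), qBinom (X : ℚ⟦X⟧) (2 * N + 1) k *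
      (C (((k - N - 1 : ℤ) : ℚ) * (-1) ^ ((k : ℤ) - N - 1)) * X ^ e (k - N - 1)) := by
  -- Among the `2N + 1` factors `q^N - z q^i`, the one with `i = N` vanishes at `z = 1`. The
  -- derivative there is thus the product of the other factors, while the sum is weighted by `k`.
  -- The undifferentiated identity `key0` has value 0 and allows the weight to be shifted to `k - N
  -- - 1`.
  have key := congrArg (Polynomial.eval 1) (congrArg Polynomial.derivative
    (prod_add_mul_pow (Polynomial.C (X : ℚ⟦X⟧)) (-Polynomial.X) (Polynomial.C (X ^ N)) (2 * N + 1)))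
  have key0 := prod_add_mul_pow (X : ℚ⟦X⟧) (-1) (X ^ N) (2 * N + 1)
  have h0 : ∏ i ∈ Finset.range (2 * N + 1), ((X : ℚ⟦X⟧) ^ N + -1 * X ^ i) = 0 :=
    Finset.prod_eq_zero (Finset.mem_range.mpr (by omega : N < 2 * N + 1)) (by ring)
  have h1 : ∏ i ∈ Finset.range N, ((X : ℚ⟦X⟧) ^ N + -1 * X ^ i) =
      (-1) ^ N * X ^ (N.choose 2) * ∏ j ∈ Finset.range N, (1 - (X : ℚ⟦X⟧) * X ^ j) := by
    have hc : (-1 : ℚ⟦X⟧) ^ N = ∏ _i ∈ Finset.range N, (-1) := by simp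
    rw [← prod_pow_range, ← Finset.prod_range_reflect (fun i => (X : ℚ⟦X⟧) ^ i),
      ← Finset.prod_range_reflect, hc, ← Finset.prod_mul_distrib, ← Finset.prod_mul_distrib]
    refine Finset.prod_congr rfl fun i hi => ?_
    have hi' := Finset.mem_range.mp hi
    have h : (X : ℚ⟦X⟧) ^ N = X ^ (N - 1 - i) * (X * X ^ i) := by
      rw [← pow_succ', ← pow_add]
      congr 1
      omega
    rw [h]
    ring
  have h2 : ∏ j ∈ Finset.range N, ((X : ℚ⟦X⟧) ^ N + -1 * X ^ (N + 1 + j)) =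
      (X ^ N) ^ N * ∏ j ∈ Finset.range N, (1 - (X : ℚ⟦X⟧) * X ^ j) := by
    have hc : ((X : ℚ⟦X⟧) ^ N) ^ N = ∏ _i ∈ Finset.range N, (X : ℚ⟦X⟧) ^ N := by simp
    rw [hc, ← Finset.prod_mul_distrib]
    refine Finset.prod_congr rfl fun i _ => ?_
    ring
  have h3 : Polynomial.eval 1 (Polynomial.derivative (∏ i ∈ Finset.range (2 * N + 1),
      (Polynomial.C ((X : ℚ⟦X⟧) ^ N) + -Polynomial.X * Polynomial.C (X : ℚ⟦X⟧) ^ i))) =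
      -(X ^ N * (∏ i ∈ Finset.range N, ((X : ℚ⟦X⟧) ^ N + -1 * X ^ i)) *
        ∏ j ∈ Finset.range N, ((X : ℚ⟦X⟧) ^ N + -1 * X ^ (N + 1 + j))) := by
    rw [show 2 * N + 1 = N + 1 + N by ring, Finset.prod_range_add, Finset.prod_range_succ,
      Polynomial.derivative_mul, Polynomial.derivative_mul]
    simp [Polynomial.eval_prod]
    left
    ring
  rw [h3, h1, h2, Polynomial.derivative_sum, Polynomial.eval_finsetSum] at key
  rw [h0] at key0
  have hne : (-1 : ℚ⟦X⟧) ^ (N + 1) * (X ^ N * X ^ (N.choose 2) * (X ^ N) ^ N) ≠ 0 :=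
    mul_ne_zero (pow_ne_zero _ (by simp)) (by simp)
  have h5 : (-1 : ℚ⟦X⟧) ^ (N + 1) * (X ^ N * X ^ (N.choose 2) * (X ^ N) ^ N) *
      ∑ k ∈ Finset.range (2 * N + 1 + 1), qBinom (X : ℚ⟦X⟧) (2 * N + 1) k *
      (C (((k - N - 1 : ℤ) : ℚ) * (-1) ^ ((k : ℤ) - N - 1)) * X ^ e (k - N - 1)) =
      (∑ k ∈ Finset.range (2 * N + 1 + 1), qBinom (X : ℚ⟦X⟧) (2 * N + 1) k * X ^ k.choose 2 *
        ((k : ℚ⟦X⟧) * (-1) ^ k) * (X ^ N) ^ (2 * N + 1 - k)) - ((N : ℚ⟦X⟧) + 1) *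
      ∑ k ∈ Finset.range (2 * N + 1 + 1), qBinom (X : ℚ⟦X⟧) (2 * N + 1) k * X ^ k.choose 2 *
        (-1) ^ k * (X ^ N) ^ (2 * N + 1 - k) := by
    rw [Finset.mul_sum, Finset.mul_sum, ← Finset.sum_sub_distrib]
    refine Finset.sum_congr rfl fun k hk => ?_
    have hk' := Finset.mem_range.mp hk
    have hs : (-1 : ℚ⟦X⟧) ^ k = (-1) ^ (N + 1) * C ((-1) ^ ((k : ℤ) - N - 1)) := by
      have : (-1 : ℚ⟦X⟧) = C (-1) := by simp
      rw [this, ← map_pow, ← map_pow, ← map_mul, ← zpow_natCast, ← zpow_natCast,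
        ← zpow_add₀ (by norm_num)]
      congr 2
      push_cast
      ring
    have hX : k.choose 2 + N * (2 * N + 1 - k) = N + N.choose 2 + N * N + e (k - N - 1) := by
      have h5 := he (k - N - 1)
      have c1 := two_mul_choose_two k
      have c2 := two_mul_choose_two N
      have c3 : ((2 * N + 1 - k : ℕ) : ℤ) = 2 * N + 1 - k := by omega
      zify
      rw [c3]
      refine mul_left_cancel₀ (two_ne_zero (α := ℤ)) ?_
      linear_combination c1 - c2 - h5
    have hX' := congrArg (fun n => (X : ℚ⟦X⟧) ^ n) hX
    simp only [pow_add, pow_mul] at hX'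
    rw [hs]
    simp only [map_mul, map_sub, map_natCast, map_one, Int.cast_sub, Int.cast_natCast, Int.cast_one]
    linear_combination (-qBinom (X : ℚ⟦X⟧) (2 * N + 1) k * ((k : ℚ⟦X⟧) - N - 1) *
      ((-1) ^ (N + 1) * C ((-1) ^ ((k : ℤ) - N - 1)))) * hX'
  have h6 : (∑ k ∈ Finset.range (2 * N + 1 + 1), Polynomial.eval 1 (Polynomial.derivative
      (qBinom (Polynomial.C (X : ℚ⟦X⟧)) (2 * N + 1) k * Polynomial.C (X : ℚ⟦X⟧) ^ k.choose 2 *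
        (-Polynomial.X) ^ k * Polynomial.C (X ^ N) ^ (2 * N + 1 - k)))) =
      ∑ k ∈ Finset.range (2 * N + 1 + 1), qBinom (X : ℚ⟦X⟧) (2 * N + 1) k * X ^ k.choose 2 *
        ((k : ℚ⟦X⟧) * (-1) ^ k) * (X ^ N) ^ (2 * N + 1 - k) := by
    refine Finset.sum_congr rfl fun k _ => ?_
    have : qBinom (Polynomial.C (X : ℚ⟦X⟧)) (2 * N + 1) k * Polynomial.C (X : ℚ⟦X⟧) ^ k.choose 2 *
        (-Polynomial.X) ^ k * Polynomial.C (X ^ N) ^ (2 * N + 1 - k) =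
        Polynomial.C (qBinom (X : ℚ⟦X⟧) (2 * N + 1) k * X ^ k.choose 2 * (-1) ^ k *
          (X ^ N) ^ (2 * N + 1 - k)) * Polynomial.X ^ k := by
      rw [← map_qBinom X (Polynomial.C : ℚ⟦X⟧ →+* _), neg_pow]
      simp only [map_mul, map_pow, map_neg, map_one]
      ring
    rw [this, Polynomial.derivative_C_mul_X_pow, Polynomial.eval_mul, Polynomial.eval_C,
      Polynomial.eval_pow, Polynomial.eval_X, one_pow]
    ring
  rw [h6] at key
  refine mul_left_cancel₀ hne ?_
  rw [h5, ← key, ← key0]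
  ring

/-- **Jacobi's identity** for the cube of Euler's product. -/
theorem hasSum_jacobi {e : ℤ → ℕ} (he : ∀ n : ℤ, 2 * (e n : ℤ) = n * (n + 1)) :
    HasSum (fun n : ℤ => C ((2 * n + 1 : ℚ) * (-1) ^ n / 2) * X ^ e n) (f 1 ^ 3) := by
  have h1 : HasSum (fun n : ℤ => C ((n : ℚ) * (-1) ^ n) * X ^ e n) (f 1 ^ 3) := by
    refine hasSum_of_qBinom (b := 1) one_pos (fun n => ?_) 1 fun N => ?_
    · have h := he n
      have h1 : 0 ≤ (n + 2) * (n + 1) := by rcases le_or_gt 0 (n + 1) with h | h <;> nlinarith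
      have h2 : 0 ≤ n * (n - 1) := by rcases le_or_gt n 0 with h | h <;> nlinarith
      rw [abs_le]
      constructor <;> nlinarith
    · have h := finite_jacobi he N
      rw [pow_one, Nat.cast_one, ← h]
      obtain ⟨u, hu⟩ := X_pow_dvd_qPochhammerInf_sub (α := (X : ℚ⟦X⟧)) dvd_rfl N
      rw [sub_eq_iff_eq_add] at hu
      have hf : f 1 = qPochhammerInf X X := by rw [f, pow_one]
      refine ⟨f 1 * u * (f 1 + ∏ j ∈ Finset.range N, (1 - (X : ℚ⟦X⟧) * X ^ j)), ?_⟩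
      rw [hf] at *
      linear_combination (qPochhammerInf (X : ℚ⟦X⟧) X) * (qPochhammerInf X X +
        ∏ j ∈ Finset.range N, (1 - (X : ℚ⟦X⟧) * X ^ j)) * hu
  -- The reflection `n ↦ -1 - n` preserves `n(n+1)/2`. Averaging replaces the coefficient `n` by
  -- `(2n + 1)/2`, which scales by `m` when `2n + 1` does.
  have h2 := (Equiv.subLeft (-1 : ℤ)).hasSum_iff.mpr h1
  have h3 := (h1.add h2).mul_left (C (1 / 2 : ℚ))
  have h4 : C (1 / 2 : ℚ) * (f 1 ^ 3 + f 1 ^ 3) = f 1 ^ 3 := by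
    have : (C (1 / 2 : ℚ) * 2 : ℚ⟦X⟧) = 1 := by
      rw [show (2 : ℚ⟦X⟧) = C 2 from (map_ofNat C 2).symm, ← map_mul]
      norm_num
    linear_combination f 1 ^ 3 * this
  rw [h4] at h3
  suffices h : (fun n : ℤ => C ((2 * n + 1 : ℚ) * (-1) ^ n / 2) * X ^ e n) = _ by rw [h]; exact h3
  funext n
  have h4 : e (-1 - n) = e n := by
    have h5 := he (-1 - n)
    have h6 := he n
    have : (-1 - n) * (-1 - n + 1) = n * (n + 1) := by ring
    rw [this] at h5
    omega
  have h5 : (-1 : ℚ) ^ (-1 - n) = -(-1) ^ n := by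
    rw [zpow_sub₀ (by norm_num)]
    rcases Int.even_or_odd n with h | h <;> simp [h.neg_one_zpow]
  simp only [Function.comp_apply, Equiv.subLeft_apply, h4, h5]
  rw [← add_mul, ← map_add, ← mul_assoc, ← map_mul]
  congr 2
  push_cast
  ring

/-! ### Product evaluations of theta functions -/

/-- The product side of the Jacobi triple product, i.e. Ramanujan's `f(ε q ^ a, ε q ^ b)`. -/
noncomputable def ramanujanTheta (ε : ℚ) (a b : ℕ) : ℚ⟦X⟧ :=
  f (a + b) * (qPochhammerInf (-(C ε * X ^ a)) (X ^ (a + b)) *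
    qPochhammerInf (-(C ε * X ^ b)) (X ^ (a + b)))

theorem f_eq_prod {b m : ℕ} (hb : b ≠ 0) (hm : m ≠ 0) :
    f b = ∏ r ∈ Finset.range m, qPochhammerInf (X ^ (b * (r + 1))) (X ^ (b * m)) := by
  rw [f, qPochhammerInf_eq_prod _ (dvd_pow_self X hb) hm]
  refine Finset.prod_congr rfl fun r _ => ?_
  congr 1 <;> ring

theorem qPochhammerInf_X_mul_neg (a : ℕ) {b : ℕ} (hb : b ≠ 0) :
    qPochhammerInf (X ^ a) (X ^ b) * qPochhammerInf (-X ^ a) (X ^ b) =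
      qPochhammerInf (X ^ (2 * a)) (X ^ (2 * b)) := by
  rw [qPochhammerInf_mul_neg _ (dvd_pow_self X hb), mul_comm 2 a, mul_comm 2 b, pow_mul, pow_mul]

theorem ramanujanTheta_one (a b : ℕ) : ramanujanTheta 1 a b =
    f (a + b) * (qPochhammerInf (-X ^ a) (X ^ (a + b)) * qPochhammerInf (-X ^ b) (X ^ (a + b))) := by
  simp [ramanujanTheta]

theorem ramanujanTheta_neg_one (a b : ℕ) : ramanujanTheta (-1) a b =
    f (a + b) * (qPochhammerInf (X ^ a) (X ^ (a + b)) * qPochhammerInf (X ^ b) (X ^ (a + b))) := by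
  simp [ramanujanTheta]

/-- The factors of `f 1` are sorted by exponent mod 3. With the triple product this is Euler's
pentagonal number theorem. -/
theorem f_one_eq_ramanujanTheta : f 1 = ramanujanTheta (-1) 2 1 := by
  rw [ramanujanTheta_neg_one, f_eq_prod one_ne_zero three_ne_zero]
  simp only [Finset.prod_range_succ, Finset.prod_range_zero, f]
  norm_num
  ring

/-- Gauss: `φ(-q) = f₁ ^ 2 / f₂`. -/
theorem ramanujanTheta_phi : ramanujanTheta (-1) 1 1 * f 2 = f 1 ^ 2 := by
  rw [ramanujanTheta_neg_one, f_eq_prod one_ne_zero two_ne_zero]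
  simp only [Finset.prod_range_succ, Finset.prod_range_zero, f]
  norm_num
  ring

/-- Gauss: `ψ(q) = f₂ ^ 2 / f₁`. -/
theorem ramanujanTheta_psi : ramanujanTheta 1 3 1 * f 1 = f 2 ^ 2 := by
  have h1 := qPochhammerInf_X_mul_neg 1 (b := 4) (by norm_num)
  have h3 := qPochhammerInf_X_mul_neg 3 (b := 4) (by norm_num)
  have h4 := f_eq_prod one_ne_zero (m := 4) (by norm_num)
  have h5 := f_eq_prod two_ne_zero (m := 4) (by norm_num)
  have h6 := f_eq_prod two_ne_zero (m := 2) (by norm_num)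
  have h7 := f_eq_prod four_ne_zero (m := 2) (by norm_num)
  rw [ramanujanTheta_one]
  simp only [Finset.prod_range_succ, Finset.prod_range_zero] at h4 h5 h6 h7
  norm_num at h1 h3 h4 h5 h6 h7 ⊢
  rw [← h1, ← h3] at h5
  rw [show qPochhammerInf (X ^ 4) (X ^ 4) = f 4 from rfl] at h4 h6
  rw [sq, h4]
  nth_rewrite 1 [h6]
  rw [h5]
  linear_combination (f 4 * qPochhammerInf (-X ^ 3) (X ^ 4) * qPochhammerInf (-X) (X ^ 4) *
    qPochhammerInf X (X ^ 4) * qPochhammerInf (X ^ 2) (X ^ 4) * qPochhammerInf (X ^ 3) (X ^ 4)) * h7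

theorem ramanujanTheta_two_one : ramanujanTheta 1 2 1 * f 1 * f 6 = f 2 * f 3 ^ 2 := by
  have h1 := qPochhammerInf_X_mul_neg 1 (b := 3) (by norm_num)
  have h2 := qPochhammerInf_X_mul_neg 2 (b := 3) (by norm_num)
  have h4 := f_eq_prod one_ne_zero (m := 3) (by norm_num)
  have h5 := f_eq_prod two_ne_zero (m := 3) (by norm_num)
  rw [ramanujanTheta_one]
  simp only [Finset.prod_range_succ, Finset.prod_range_zero] at h4 h5
  norm_num at h1 h2 h4 h5 ⊢
  rw [show f 6 = qPochhammerInf (X ^ 6) (X ^ 6) from rfl, h4, h5, ← h1, ← h2,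
    show f 3 = qPochhammerInf (X ^ 3) (X ^ 3) from rfl]
  ring

theorem ramanujanTheta_neg_five_one : ramanujanTheta (-1) 5 1 * f 2 * f 3 = f 1 * f 6 ^ 2 := by
  have h4 := f_eq_prod one_ne_zero (m := 6) (by norm_num)
  have h5 := f_eq_prod two_ne_zero (m := 3) (by norm_num)
  have h6 := f_eq_prod three_ne_zero (m := 2) (by norm_num)
  rw [ramanujanTheta_neg_one]
  simp only [Finset.prod_range_succ, Finset.prod_range_zero] at h4 h5 h6
  norm_num at h4 h5 h6 ⊢
  rw [show f 6 = qPochhammerInf (X ^ 6) (X ^ 6) from rfl, h4, h5, h6]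
  ring

theorem ramanujanTheta_five_one :
    ramanujanTheta (-1) 5 1 * ramanujanTheta 1 5 1 * f 12 =
      expand 2 two_ne_zero (ramanujanTheta (-1) 5 1) * f 6 ^ 2 := by
  have h1 := qPochhammerInf_X_mul_neg 1 (b := 6) (by norm_num)
  have h2 := qPochhammerInf_X_mul_neg 5 (b := 6) (by norm_num)
  rw [ramanujanTheta_one, ramanujanTheta_neg_one, map_mul, map_mul, expand_f two_ne_zero (by norm_num),
    expand_qPochhammerInf _ _ (dvd_pow_self X (by norm_num)),
    expand_qPochhammerInf _ _ (dvd_pow_self X (by norm_num))]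
  simp only [map_pow, expand_X, ← pow_mul]
  norm_num at h1 h2 ⊢
  rw [← h1, ← h2]
  ring

/-! ### Dissection into residue classes of exponents -/

/-- The part of a power series supported on the exponents congruent to `s` modulo `m`. -/
noncomputable def comp (m : ℕ) (s : ZMod m) : ℚ⟦X⟧ →ₗ[ℚ] ℚ⟦X⟧ where
  toFun F := PowerSeries.mk fun n => if (n : ZMod m) = s then coeff n F else 0
  map_add' F G := by ext n; by_cases h : (n : ZMod m) = s <;> simp [h]
  map_smul' c F := by ext n; by_cases h : (n : ZMod m) = s <;> simp [h]

theorem coeff_comp (m : ℕ) (s : ZMod m) (F : ℚ⟦X⟧) (n : ℕ) :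
    coeff n (comp m s F) = if (n : ZMod m) = s then coeff n F else 0 := by
  simp [comp]

theorem continuous_comp (m : ℕ) (s : ZMod m) : Continuous (comp m s) := by
  refine continuous_iff_continuousAt.mpr fun F => ?_
  rw [ContinuousAt, PowerSeries.WithPiTopology.tendsto_iff_coeff_tendsto]
  intro d
  simp only [coeff_comp]
  split_ifs
  · exact ((PowerSeries.WithPiTopology.continuous_coeff ℚ _).tendsto F)
  · exact tendsto_const_nhds

theorem comp_mul {m : ℕ} [NeZero m] (t : ZMod m) (F G : ℚ⟦X⟧) :
    comp m t (F * G) = ∑ s : ZMod m, comp m s F * comp m (t - s) G := by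
  ext n
  rw [coeff_comp, map_sum]
  simp only [coeff_mul, coeff_comp]
  rw [Finset.sum_comm]
  split_ifs with h
  · refine Finset.sum_congr rfl fun p hp => ?_
    have hp' : (p.1 : ZMod m) + p.2 = t := by
      rw [← h, ← Finset.HasAntidiagonal.mem_antidiagonal.mp hp, Nat.cast_add]
    rw [Finset.sum_eq_single (p.1 : ZMod m)]
    · rw [if_pos rfl, if_pos (by rw [← hp']; ring)]
    · intro s _ hs
      rw [if_neg (Ne.symm hs), zero_mul]
    · simp
  · refine (Finset.sum_eq_zero fun p hp => Finset.sum_eq_zero fun s _ => ?_).symm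
    have hp' : (p.1 : ZMod m) + p.2 ≠ t := by
      rwa [← Nat.cast_add, Finset.HasAntidiagonal.mem_antidiagonal.mp hp]
    by_cases h1 : (p.1 : ZMod m) = s
    · rw [if_neg (c := (p.2 : ZMod m) = t - s), mul_zero]
      intro h2
      apply hp'
      rw [h1, h2]
      ring
    · rw [if_neg h1, zero_mul]

/-- Multiplication by a series in `X ^ m` commutes with taking components. -/
theorem comp_mul_expand {m : ℕ} (hm : m ≠ 0) (s : ZMod m) (F G : ℚ⟦X⟧) :
    comp m s (F * expand m hm G) = comp m s F * expand m hm G := by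
  ext n
  rw [coeff_comp, coeff_mul, coeff_mul]
  split_ifs with h
  · refine Finset.sum_congr rfl fun p hp => ?_
    rw [coeff_comp]
    split_ifs with h1
    · rfl
    · rw [coeff_expand_of_not_dvd, mul_zero, mul_zero]
      intro h2
      rw [← Finset.HasAntidiagonal.mem_antidiagonal.mp hp, Nat.cast_add, (ZMod.natCast_eq_zero_iff _ _).mpr h2,
        add_zero] at h
      exact h1 h
  · refine (Finset.sum_eq_zero fun p hp => ?_).symm
    rw [coeff_comp]
    split_ifs with h1
    · rw [coeff_expand_of_not_dvd, mul_zero]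
      intro h2
      rw [← Finset.HasAntidiagonal.mem_antidiagonal.mp hp, Nat.cast_add, (ZMod.natCast_eq_zero_iff _ _).mpr h2,
        add_zero] at h
      exact h h1
    · rw [zero_mul]

theorem comp_expand_mul {m l : ℕ} (hl : l ≠ 0) (hlm : Nat.Coprime l m) (s : ZMod m) (F : ℚ⟦X⟧) :
    comp m (l * s) (expand l hl F) = expand l hl (comp m s F) := by
  ext n
  rw [coeff_comp]
  by_cases h : l ∣ n
  · obtain ⟨j, rfl⟩ := h
    rw [coeff_expand_mul, coeff_expand_mul, coeff_comp, Nat.cast_mul]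
    have hu : IsUnit (l : ZMod m) := (ZMod.isUnit_iff_coprime l m).mpr hlm
    simp only [hu.mul_right_inj]
  · rw [coeff_expand_of_not_dvd _ _ _ h, coeff_expand_of_not_dvd _ _ _ h, ite_self]

theorem hasSum_comp {ι : Type*} {m : ℕ} (s : ZMod m) {c : ι → ℚ} {e : ι → ℕ} {F : ℚ⟦X⟧}
    (h : HasSum (fun n => C (c n) * X ^ e n) F) :
    HasSum (fun n => if (e n : ZMod m) = s then C (c n) * X ^ e n else 0) (comp m s F) := by
  have := h.map (comp m s) (continuous_comp m s)
  suffices h' : (fun n => if (e n : ZMod m) = s then C (c n) * (X : ℚ⟦X⟧) ^ e n else 0) = _ by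
    rw [h']; exact this
  funext n
  ext d
  rw [Function.comp_apply, coeff_comp, coeff_C_mul, coeff_X_pow]
  by_cases h1 : d = e n
  · rw [h1]
    by_cases h2 : (e n : ZMod m) = s <;> simp [h2]
  · split_ifs <;> simp [coeff_X_pow, h1]

theorem comp_eq_zero_of_hasSum {ι : Type*} {m : ℕ} {s : ZMod m} {c : ι → ℚ} {e : ι → ℕ} {F : ℚ⟦X⟧}
    (h : HasSum (fun n => C (c n) * X ^ e n) F) (hs : ∀ n, (e n : ZMod m) ≠ s) :
    comp m s F = 0 := by
  have := hasSum_comp s h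
  simp only [hs, if_false] at this
  exact this.unique hasSum_zero

/-! ### Self-similarity and its link to matching coefficients -/

/-- The component of `F` along the exponents congruent to `r` is `c q ^ r F(q ^ (m ^ 2))`. -/
def SelfSimilar (m : ℕ) (hm : m ≠ 0) (r : ℕ) (c : ℚ) (F : ℚ⟦X⟧) : Prop :=
  comp m r F = C c * X ^ r * expand m hm (expand m hm F)

theorem SelfSimilar.expand {m : ℕ} {hm : m ≠ 0} {r : ℕ} {c : ℚ} {F : ℚ⟦X⟧}
    (h : SelfSimilar m hm r c F) {l : ℕ} (hl : l ≠ 0) (hlm : Nat.Coprime l m) :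
    SelfSimilar m hm (l * r) c (expand l hl F) := by
  rw [SelfSimilar, Nat.cast_mul, comp_expand_mul hl hlm, h]
  simp only [map_mul, map_pow, expand_C, expand_X, ← expand_mul, ← pow_mul]
  simp only [mul_comm, mul_left_comm]

/-- The hypothesis kills every term of the convolution over classes except the product of the two
self-similar components. -/
theorem SelfSimilar.mul {m : ℕ} {hm : m ≠ 0} {r r' : ℕ} {c c' : ℚ} {F G : ℚ⟦X⟧}
    (hF : SelfSimilar m hm r c F) (hG : SelfSimilar m hm r' c' G)
    (h : ∀ s : ZMod m, s ≠ r → comp m s F = 0 ∨ comp m (r + r' - s) G = 0) :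
    SelfSimilar m hm (r + r') (c * c') (F * G) := by
  have : NeZero m := ⟨hm⟩
  rw [SelfSimilar, comp_mul, Finset.sum_eq_single (r : ZMod m)]
  · rw [Nat.cast_add, add_sub_cancel_left, hF, hG]
    simp only [map_mul]
    ring
  · intro s _ hs
    rcases h s hs with h1 | h1
    · rw [h1, zero_mul]
    · rw [Nat.cast_add, h1, mul_zero]
  · simp

theorem expand_inv {m : ℕ} (hm : m ≠ 0) {F : ℚ⟦X⟧} (hF : constantCoeff F ≠ 0) :
    expand m hm F⁻¹ = (expand m hm F)⁻¹ := by
  rw [PowerSeries.eq_inv_iff_mul_eq_one (by rwa [constantCoeff_expand]), ← map_mul,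
    PowerSeries.inv_mul_cancel _ hF, map_one]

/-- Since `1 / F(q^m)` is a series in `q^m`, the component of the quotient is `c q^r F(q^(m^2)) /
F(q^m)`, that is `c q^r` times the reciprocal quotient evaluated at `q^m`. -/
theorem SelfSimilar.coeff_eq {m : ℕ} {hm : m ≠ 0} {r : ℕ} {c : ℚ} {F : ℚ⟦X⟧}
    (h : SelfSimilar m hm r c F) (hF : constantCoeff F ≠ 0) (n : ℕ) :
    coeff (m * n + r) (F * (PowerSeries.expand m hm F)⁻¹) =
      c * coeff n (F * (PowerSeries.expand m hm F)⁻¹)⁻¹ := by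
  have h1 : coeff (m * n + r) (F * (PowerSeries.expand m hm F)⁻¹) =
      coeff (m * n + r) (comp m r (F * (PowerSeries.expand m hm F)⁻¹)) := by
    rw [coeff_comp, if_pos (by simp)]
  rw [h1, ← expand_inv hm hF, comp_mul_expand, h, mul_assoc (C c), mul_assoc (C c), coeff_C_mul,
    mul_assoc, ← map_mul, coeff_X_pow_mul, coeff_expand_mul, PowerSeries.mul_inv_rev,
    expand_inv hm hF, (PowerSeries.inv_eq_iff_mul_eq_one (φ := PowerSeries.expand m hm F)
      (by simpa)).mpr (PowerSeries.mul_inv_cancel _ (by simpa))]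

/-- Self-similarity of unary theta series. -/
theorem selfSimilar_of_hasSum {m : ℕ} [hm : Fact m.Prime] {F : ℚ⟦X⟧} {c : ℤ → ℚ} {e : ℤ → ℕ}
    (hF : HasSum (fun n => C (c n) * X ^ e n) F) {D s w : ℤ}
    (he : ∀ n, D * e n + w ^ 2 = (s * n + w) ^ 2) (hD : (D : ZMod m) ≠ 0) (hs : (s : ZMod m) ≠ 0)
    {n₀ σ : ℤ} (hσ : σ ^ 2 = 1) (hn₀ : s * n₀ + w = σ * m * w) {r : ℕ}
    (hr : D * r = w ^ 2 * (m ^ 2 - 1)) {γ : ℚ} (hc : ∀ k, c (n₀ + σ * m * k) = γ * c k) :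
    SelfSimilar m hm.out.ne_zero r γ F := by
  have hm0 : m ≠ 0 := hm.out.ne_zero
  have hD0 : D ≠ 0 := by rintro rfl; simp at hD
  have hσ0 : σ ≠ 0 := by rintro rfl; simp at hσ
  -- Along this progression `s n + w = σ m (s k + w)`, so the completed square is multiplied by
  -- `m^2`. The sign `σ` is available because `m` need only be `± 1` modulo `s` when `w = 1`.
  have heg (k : ℤ) : e (n₀ + σ * m * k) = r + m ^ 2 * e k := by
    zify
    refine mul_left_cancel₀ hD0 ?_
    have h1 := he (n₀ + σ * m * k)
    have h2 := he k
    have h3 : s * (n₀ + σ * m * k) + w = σ * (m * (s * k + w)) := by linear_combination hn₀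
    rw [h3, mul_pow, hσ] at h1
    linear_combination h1 - hr - (m : ℤ) ^ 2 * h2
  have h1 := hasSum_comp (m := m) (r : ZMod m) hF
  let g : ℤ → ℤ := fun k => n₀ + σ * m * k
  have hg : Function.Injective g := fun x y hxy => by
    have : σ * m * x = σ * m * y := by simpa [g] using hxy
    exact mul_left_cancel₀ (mul_ne_zero hσ0 (by exact_mod_cast hm0)) this
  rw [← hg.hasSum_iff] at h1
  · have h2 := ((hF.map (PowerSeries.expand m hm0) (continuous_expand hm0)).map
      (PowerSeries.expand m hm0) (continuous_expand hm0)).mul_left (C γ * X ^ r)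
    refine h1.unique ?_
    suffices h' : (fun n => if (e n : ZMod m) = (r : ZMod m) then C (c n) * (X : ℚ⟦X⟧) ^ e n else 0) ∘ g
        = _ by rw [h']; exact h2
    funext k
    simp only [Function.comp_apply, g, heg, hc]
    rw [if_pos (by simp)]
    simp only [map_mul, map_pow, expand_C, expand_X, ← pow_mul]
    ring
  -- Off the progression nothing survives: an exponent congruent to `r` forces `(s n + w)^2 ≡ w^2
  -- m^2 ≡ 0`, hence `n ≡ n₀` mod `m`.
  · intro n hn
    rw [if_neg]
    intro h2
    apply hn
    have h3 : ((s * n + w : ℤ) : ZMod m) = 0 := by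
      have h4 := congrArg (Int.cast : ℤ → ZMod m) (he n)
      have h5 := congrArg (Int.cast : ℤ → ZMod m) hr
      push_cast at h4 h5 ⊢
      rw [h2, h5, ZMod.natCast_self] at h4
      refine pow_eq_zero_iff two_ne_zero |>.mp (h4.symm.trans ?_)
      ring
    have h6 : ((n - n₀ : ℤ) : ZMod m) = 0 := by
      refine (mul_eq_zero.mp ?_ : (s : ZMod m) = 0 ∨ _).resolve_left hs
      have h5 := congrArg (Int.cast : ℤ → ZMod m) hn₀
      push_cast at h3 h5 ⊢
      rw [ZMod.natCast_self] at h5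
      linear_combination h3 - h5
    rw [ZMod.intCast_zmod_eq_zero_iff_dvd] at h6
    obtain ⟨k, hk⟩ := h6
    refine ⟨σ * k, ?_⟩
    simp only [g]
    linear_combination (-1 : ℤ) * hk + (m : ℤ) * k * hσ

/-- The residues supporting a series of the form `∑ c(n) q ^ (l ((s n + 1) ^ 2 - 1) / D)`. -/
def SquareSupport (m : ℕ) (D l : ZMod m) (F : ℚ⟦X⟧) : Prop :=
  ∀ s : ZMod m, (∀ x, D * s + l ≠ l * x ^ 2) → comp m s F = 0

theorem squareSupport_of_hasSum {m : ℕ} {F : ℚ⟦X⟧} {c : ℤ → ℚ} {e : ℤ → ℕ}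
    (hF : HasSum (fun n => C (c n) * X ^ e n) F) {D s : ℤ}
    (he : ∀ n, D * e n + 1 = (s * n + 1) ^ 2) : SquareSupport m D 1 F := by
  intro t ht
  refine comp_eq_zero_of_hasSum hF fun n hn => ht ((s * n + 1 : ℤ) : ZMod m) ?_
  have h := congrArg (Int.cast : ℤ → ZMod m) (he n)
  rw [← hn]
  push_cast at h ⊢
  rw [h, one_mul]

theorem SquareSupport.expand {m : ℕ} {D k : ZMod m} {F : ℚ⟦X⟧} (h : SquareSupport m D k F) {l : ℕ}
    (hl : l ≠ 0) (hlm : Nat.Coprime l m) : SquareSupport m D (l * k) (expand l hl F) := by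
  intro t ht
  have hu : IsUnit (l : ZMod m) := (ZMod.isUnit_iff_coprime l m).mpr hlm
  obtain ⟨u, hu⟩ := hu
  have h1 : t = l * (↑u⁻¹ * t) := by rw [← hu, Units.mul_inv_cancel_left]
  rw [h1, comp_expand_mul hl hlm, h, map_zero]
  intro x hx
  apply ht x
  rw [h1]
  linear_combination (l : ZMod m) * hx

/-! ### Self-similarity and supports of the basic theta series -/

theorem exists_hasSum_ramanujanTheta {ε : ℚ} (hε : ε * ε = 1) {a b : ℕ} (ha : 0 < a) (hb : 0 < b) :
    ∃ e : ℤ → ℕ, (∀ n : ℤ, 2 * (e n : ℤ) = a * (n * (n + 1)) + b * (n * (n - 1))) ∧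
      HasSum (fun n : ℤ => C (ε ^ n) * X ^ e n) (ramanujanTheta ε a b) := by
  have h : ∀ n : ℤ, ∃ e : ℕ, 2 * (e : ℤ) = a * (n * (n + 1)) + b * (n * (n - 1)) := by
    intro n
    obtain ⟨u, hu⟩ := (Int.even_mul_succ_self n).two_dvd
    obtain ⟨v, hv⟩ := (Int.even_mul_pred_self n).two_dvd
    have hu0 : 0 ≤ u := by
      have : 0 ≤ n * (n + 1) := by rcases le_or_gt 0 n with h | h <;> nlinarith
      omega
    have hv0 : 0 ≤ v := by
      have : 0 ≤ n * (n - 1) := by rcases le_or_gt n 0 with h | h <;> nlinarith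
      omega
    refine ⟨(a * u + b * v).toNat, ?_⟩
    rw [Int.toNat_of_nonneg (by positivity), hu, hv]
    ring
  choose e he using h
  exact ⟨e, he, hasSum_tripleProduct hε ha hb he⟩

theorem zpow_add_odd_mul {ε : ℚ} (hε : ε * ε = 1) {m : ℕ} (hm : Odd m) {σ : ℤ} (hσ : σ ^ 2 = 1)
    (n k : ℤ) : ε ^ (n + σ * m * k) = ε ^ n * ε ^ k := by
  have hε0 : ε ≠ 0 := left_ne_zero_of_mul_eq_one hε
  have h2 : ε ^ (2 : ℤ) = 1 := by rw [← hε]; norm_cast; ring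
  have hodd : Odd (σ * m) := by
    refine Odd.mul ?_ (by exact_mod_cast hm)
    rcases mul_self_eq_one_iff.mp ((sq σ).symm.trans hσ) with rfl | rfl <;> decide
  obtain ⟨t, ht⟩ := hodd
  rw [zpow_add₀ hε0, ht, show (2 * t + 1) * k = 2 * (t * k) + k by ring, zpow_add₀ hε0, zpow_mul,
    h2, one_zpow, one_mul]

theorem selfSimilar_ramanujanTheta_two_one {m : ℕ} [hm : Fact m.Prime] (hm2 : Odd m)
    (h6 : ((6 : ℤ) : ZMod m) ≠ 0) (h24 : ((24 : ℤ) : ZMod m) ≠ 0) {ε : ℚ} (hε : ε * ε = 1)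
    {n₀ σ : ℤ} (hσ : σ ^ 2 = 1) (hn₀ : 6 * n₀ + 1 = σ * m) {r : ℕ} (hr : 24 * (r : ℤ) = m ^ 2 - 1) :
    SelfSimilar m hm.out.ne_zero r (ε ^ n₀) (ramanujanTheta ε 2 1) := by
  obtain ⟨e, he, h⟩ := exists_hasSum_ramanujanTheta hε two_pos one_pos
  -- The exponents are `n(3n + 1)/2`, and `24 e + 1 = (6n + 1)^2`.
  refine selfSimilar_of_hasSum h (D := 24) (s := 6) (w := 1) (n₀ := n₀) (σ := σ)
    (fun n => ?_) h24 h6 hσ ?_ ?_ fun k => zpow_add_odd_mul hε hm2 hσ _ _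
  · have := he n
    push_cast at this
    linear_combination 12 * this
  · linear_combination hn₀
  · linear_combination hr

theorem squareSupport_ramanujanTheta_two_one (m : ℕ) {ε : ℚ} (hε : ε * ε = 1) :
    SquareSupport m 24 1 (ramanujanTheta ε 2 1) := by
  obtain ⟨e, he, h⟩ := exists_hasSum_ramanujanTheta hε two_pos one_pos
  rw [← Int.cast_ofNat (R := ZMod m) 24]
  refine squareSupport_of_hasSum h (D := 24) (s := 6) fun n => ?_
  have := he n
  push_cast at this
  linear_combination 12 * this

theorem selfSimilar_ramanujanTheta_three_one {m : ℕ} [hm : Fact m.Prime]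
    (h4 : ((4 : ℤ) : ZMod m) ≠ 0) (h8 : ((8 : ℤ) : ZMod m) ≠ 0)
    {n₀ σ : ℤ} (hσ : σ ^ 2 = 1) (hn₀ : 4 * n₀ + 1 = σ * m) {r : ℕ} (hr : 8 * (r : ℤ) = m ^ 2 - 1) :
    SelfSimilar m hm.out.ne_zero r 1 (ramanujanTheta 1 3 1) := by
  obtain ⟨e, he, h⟩ := exists_hasSum_ramanujanTheta (mul_one 1) three_pos one_pos
  -- The exponents are `n(2n + 1)`, and `8 e + 1 = (4n + 1)^2`.
  refine selfSimilar_of_hasSum h (D := 8) (s := 4) (w := 1) (n₀ := n₀) (σ := σ)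
    (fun n => ?_) h8 h4 hσ ?_ ?_ fun k => by simp
  · have := he n
    push_cast at this
    linear_combination 4 * this
  · linear_combination hn₀
  · linear_combination hr

theorem squareSupport_ramanujanTheta_three_one (m : ℕ) :
    SquareSupport m 8 1 (ramanujanTheta 1 3 1) := by
  obtain ⟨e, he, h⟩ := exists_hasSum_ramanujanTheta (mul_one 1) three_pos one_pos
  rw [← Int.cast_ofNat (R := ZMod m) 8]
  refine squareSupport_of_hasSum h (D := 8) (s := 4) fun n => ?_
  have := he n
  push_cast at this
  linear_combination 4 * this

theorem exists_hasSum_jacobi : ∃ e : ℤ → ℕ, (∀ n : ℤ, 2 * (e n : ℤ) = n * (n + 1)) ∧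
    HasSum (fun n : ℤ => C ((2 * n + 1 : ℚ) * (-1) ^ n / 2) * X ^ e n) (f 1 ^ 3) := by
  have h : ∀ n : ℤ, ∃ e : ℕ, 2 * (e : ℤ) = n * (n + 1) := by
    intro n
    obtain ⟨u, hu⟩ := (Int.even_mul_succ_self n).two_dvd
    have : 0 ≤ n * (n + 1) := by rcases le_or_gt 0 n with h | h <;> nlinarith
    exact ⟨u.toNat, by omega⟩
  choose e he using h
  exact ⟨e, he, hasSum_jacobi he⟩

theorem selfSimilar_f_one_cube {m : ℕ} [hm : Fact m.Prime] (h2 : ((2 : ℤ) : ZMod m) ≠ 0)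
    (h8 : ((8 : ℤ) : ZMod m) ≠ 0) {n₀ : ℕ} (hn₀ : 2 * n₀ + 1 = m)
    {r : ℕ} (hr : 8 * (r : ℤ) = m ^ 2 - 1) :
    SelfSimilar m hm.out.ne_zero r (m * (-1) ^ n₀) (f 1 ^ 3) := by
  obtain ⟨e, he, h⟩ := exists_hasSum_jacobi
  refine selfSimilar_of_hasSum h (D := 8) (s := 2) (w := 1) (n₀ := n₀) (σ := 1)
    (fun n => ?_) h8 h2 (one_pow 2) ?_ ?_ fun k => ?_
  · linear_combination 4 * he n
  · rw [← hn₀]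
    push_cast
    ring
  · linear_combination hr
  · rw [zpow_add_odd_mul (by norm_num) ⟨n₀, hn₀.symm⟩ (one_pow 2), zpow_natCast, ← hn₀]
    push_cast
    ring

theorem squareSupport_f_one_cube (m : ℕ) : SquareSupport m 8 1 (f 1 ^ 3) := by
  obtain ⟨e, he, h⟩ := exists_hasSum_jacobi
  rw [← Int.cast_ofNat (R := ZMod m) 8]
  refine squareSupport_of_hasSum h (D := 8) (s := 2) fun n => ?_
  linear_combination 4 * he n

theorem squareSupport_f_one (m : ℕ) : SquareSupport m 24 1 (f 1) := by
  rw [f_one_eq_ramanujanTheta]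
  exact squareSupport_ramanujanTheta_two_one m (by norm_num)

instance fact_prime_eleven : Fact (Nat.Prime 11) := ⟨by norm_num⟩

instance fact_prime_five : Fact (Nat.Prime 5) := ⟨by norm_num⟩

instance fact_prime_seven : Fact (Nat.Prime 7) := ⟨by norm_num⟩

theorem selfSimilar_f_one_five : SelfSimilar 5 (by norm_num) 1 (-1) (f 1) := by
  have := selfSimilar_ramanujanTheta_two_one (m := 5) (by decide) (by decide) (by decide)
    (ε := -1) (by norm_num) (n₀ := -1) (σ := -1) (by norm_num) (by norm_num) (r := 1) (by norm_num)
  rw [f_one_eq_ramanujanTheta]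
  simpa using this

theorem selfSimilar_f_one_seven : SelfSimilar 7 (by norm_num) 2 (-1) (f 1) := by
  have := selfSimilar_ramanujanTheta_two_one (m := 7) (by decide) (by decide) (by decide)
    (ε := -1) (by norm_num) (n₀ := 1) (σ := 1) (by norm_num) (by norm_num) (r := 2) (by norm_num)
  rw [f_one_eq_ramanujanTheta]
  simpa using this

theorem selfSimilar_f_one_eleven : SelfSimilar 11 (by norm_num) 5 1 (f 1) := by
  have := selfSimilar_ramanujanTheta_two_one (m := 11) (by decide) (by decide) (by decide)
    (ε := -1) (by norm_num) (n₀ := -2) (σ := -1) (by norm_num) (by norm_num) (r := 5) (by norm_num)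
  rw [f_one_eq_ramanujanTheta]
  norm_num at this
  exact this

theorem selfSimilar_f_one_cube_three : SelfSimilar 3 (by norm_num) 1 (-3) (f 1 ^ 3) := by
  have := selfSimilar_f_one_cube (m := 3) (by decide) (by decide) (n₀ := 1) (by norm_num) (r := 1)
    (by norm_num)
  norm_num at this
  exact this

theorem selfSimilar_f_one_cube_five : SelfSimilar 5 (by norm_num) 3 5 (f 1 ^ 3) := by
  have := selfSimilar_f_one_cube (m := 5) (by decide) (by decide) (n₀ := 2) (by norm_num) (r := 3)
    (by norm_num)
  norm_num at this
  exact this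

theorem selfSimilar_f_one_cube_seven : SelfSimilar 7 (by norm_num) 6 (-7) (f 1 ^ 3) := by
  have := selfSimilar_f_one_cube (m := 7) (by decide) (by decide) (n₀ := 3) (by norm_num) (r := 6)
    (by norm_num)
  norm_num at this
  exact this

/-! ### The anisotropic cases -/

/-- Multiplicativity of self-similarity when the quadratic form attached to the two supports is
anisotropic. -/
theorem SelfSimilar.mul_of_anisotropic {m : ℕ} {hm : m ≠ 0} {r r' : ℕ} {c c' : ℚ} {F G : ℚ⟦X⟧}
    (hF : SelfSimilar m hm r c F) (hG : SelfSimilar m hm r' c' G) {D l D' l' : ZMod m}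
    (hF' : SquareSupport m D l F) (hG' : SquareSupport m D' l' G)
    (h : ∀ s : ZMod m, s ≠ r → (∀ x, D * s + l ≠ l * x ^ 2) ∨
      ∀ x, D' * (r + r' - s) + l' ≠ l' * x ^ 2) :
    SelfSimilar m hm (r + r') (c * c') (F * G) :=
  hF.mul hG fun s hs => (h s hs).imp (hF' s) (hG' _)

theorem δ_eq_of_selfSimilar {m : ℕ} {hm : m ≠ 0} {r k : ℕ} {c : ℚ}
    (h : SelfSimilar m hm r c (f 1 ^ k)) (n : ℕ) : δ m k (m * n + r) = c * δ' m k n := by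
  have := h.coeff_eq (by simp [constantCoeff_f one_pos]) n
  rwa [map_pow, expand_f hm one_ne_zero, mul_one] at this

theorem δ₂_eq_of_selfSimilar {m : ℕ} {hm : m ≠ 0} {r l k : ℕ} (hl : l ≠ 0) {c : ℚ}
    (h : SelfSimilar m hm r c (f 1 ^ k * f l ^ k)) (n : ℕ) :
    δ₂ l m k (m * n + r) = c * δ₂' l m k n := by
  have := h.coeff_eq (by simp [constantCoeff_f one_pos, constantCoeff_f (Nat.pos_of_ne_zero hl)]) n
  rwa [map_mul (PowerSeries.expand m hm), map_pow, map_pow, expand_f hm one_ne_zero,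
    expand_f hm hl, mul_one, mul_comm m l] at this

theorem δ_three_three (n : ℕ) : δ 3 3 (3 * n + 1) = -3 * δ' 3 3 n :=
  δ_eq_of_selfSimilar selfSimilar_f_one_cube_three n

theorem δ_three_six (n : ℕ) : δ 3 6 (3 * n + 2) = 9 * δ' 3 6 n := by
  have h := selfSimilar_f_one_cube_three.mul_of_anisotropic selfSimilar_f_one_cube_three
    (squareSupport_f_one_cube 3) (squareSupport_f_one_cube 3) (by decide)
  rw [← pow_add] at h
  norm_num at h
  exact δ_eq_of_selfSimilar h n

theorem δ_five_three (n : ℕ) : δ 5 3 (5 * n + 3) = 5 * δ' 5 3 n :=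
  δ_eq_of_selfSimilar selfSimilar_f_one_cube_five n

theorem δ_five_four (n : ℕ) : δ 5 4 (5 * n + 4) = -5 * δ' 5 4 n := by
  -- From `24 s + 1 = x^2` and `8 (4 - s) + 1 = y^2` one gets `x^2 + 3 y^2 = 0` mod 5, a form with
  -- only the trivial zero. The final `decide` verifies this class by class.
  have h := selfSimilar_f_one_five.mul_of_anisotropic selfSimilar_f_one_cube_five
    (squareSupport_f_one 5) (squareSupport_f_one_cube 5) (by decide)
  rw [← pow_succ'] at h
  norm_num at h
  exact δ_eq_of_selfSimilar h n

theorem δ_seven_two (n : ℕ) : δ 7 2 (7 * n + 4) = δ' 7 2 n := by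
  have h := selfSimilar_f_one_seven.mul_of_anisotropic selfSimilar_f_one_seven
    (squareSupport_f_one 7) (squareSupport_f_one 7) (by decide)
  rw [← sq (f 1)] at h
  simpa using δ_eq_of_selfSimilar h n

theorem δ_seven_three (n : ℕ) : δ 7 3 (7 * n + 6) = -7 * δ' 7 3 n :=
  δ_eq_of_selfSimilar selfSimilar_f_one_cube_seven n

theorem δ_seven_six (n : ℕ) : δ 7 6 (7 * n + 12) = 49 * δ' 7 6 n := by
  have h := selfSimilar_f_one_cube_seven.mul_of_anisotropic selfSimilar_f_one_cube_seven
    (squareSupport_f_one_cube 7) (squareSupport_f_one_cube 7) (by decide)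
  rw [← pow_add] at h
  norm_num at h
  exact δ_eq_of_selfSimilar h n

theorem δ_eleven_two (n : ℕ) : δ 11 2 (11 * n + 10) = δ' 11 2 n := by
  have h := selfSimilar_f_one_eleven.mul_of_anisotropic selfSimilar_f_one_eleven
    (squareSupport_f_one 11) (squareSupport_f_one 11) (by decide)
  rw [← sq (f 1)] at h
  simpa using δ_eq_of_selfSimilar h n

/-- Self-similarity of `f₁ f_l` in the anisotropic case. -/
theorem SelfSimilar.f_one_mul_f {m : ℕ} {hm : m ≠ 0} {r : ℕ} {c : ℚ}
    (h : SelfSimilar m hm r c (f 1)) {l : ℕ} (hl : l ≠ 0) (hlm : Nat.Coprime l m)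
    (h' : ∀ s : ZMod m, s ≠ r → (∀ x, 24 * s + 1 ≠ 1 * x ^ 2) ∨
      ∀ x, 24 * (r + (l * r : ℕ) - s) + l * 1 ≠ l * 1 * x ^ 2) :
    SelfSimilar m hm (r + l * r) (c * c) (f 1 ^ 1 * f l ^ 1) := by
  have h1 := h.mul_of_anisotropic (h.expand hl hlm) (squareSupport_f_one m)
    ((squareSupport_f_one m).expand hl hlm) h'
  rwa [expand_f hl one_ne_zero, mul_one, ← pow_one (f 1), ← pow_one (f l)] at h1

/-- Self-similarity of `(f₁ f_l) ^ 3` in the anisotropic case. -/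
theorem SelfSimilar.f_one_cube_mul_f_cube {m : ℕ} {hm : m ≠ 0} {r : ℕ} {c : ℚ}
    (h : SelfSimilar m hm r c (f 1 ^ 3)) {l : ℕ} (hl : l ≠ 0) (hlm : Nat.Coprime l m)
    (h' : ∀ s : ZMod m, s ≠ r → (∀ x, 8 * s + 1 ≠ 1 * x ^ 2) ∨
      ∀ x, 8 * (r + (l * r : ℕ) - s) + l * 1 ≠ l * 1 * x ^ 2) :
    SelfSimilar m hm (r + l * r) (c * c) (f 1 ^ 3 * f l ^ 3) := by
  have h1 := h.mul_of_anisotropic (h.expand hl hlm) (squareSupport_f_one_cube m)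
    ((squareSupport_f_one_cube m).expand hl hlm) h'
  rwa [map_pow, expand_f hl one_ne_zero, mul_one] at h1

theorem δ₂_two_five_one (n : ℕ) : δ₂ 2 5 1 (5 * n + 3) = δ₂' 2 5 1 n := by
  simpa using δ₂_eq_of_selfSimilar two_ne_zero (selfSimilar_f_one_five.f_one_mul_f
    two_ne_zero (by norm_num) (by decide)) n

theorem δ₂_two_five_three (n : ℕ) : δ₂ 2 5 3 (5 * n + 9) = 25 * δ₂' 2 5 3 n := by
  have := δ₂_eq_of_selfSimilar two_ne_zero (selfSimilar_f_one_cube_five.f_one_cube_mul_f_cube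
    two_ne_zero (by norm_num) (by decide)) n
  norm_num at this
  exact this

theorem δ₂_three_five_one (n : ℕ) : δ₂ 3 5 1 (5 * n + 4) = δ₂' 3 5 1 n := by
  simpa using δ₂_eq_of_selfSimilar three_ne_zero (selfSimilar_f_one_five.f_one_mul_f
    three_ne_zero (by norm_num) (by decide)) n

theorem δ₂_three_five_three (n : ℕ) : δ₂ 3 5 3 (5 * n + 12) = 25 * δ₂' 3 5 3 n := by
  have := δ₂_eq_of_selfSimilar three_ne_zero (selfSimilar_f_one_cube_five.f_one_cube_mul_f_cube
    three_ne_zero (by norm_num) (by decide)) n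
  norm_num at this
  exact this

theorem δ₂_two_seven_one (n : ℕ) : δ₂ 2 7 1 (7 * n + 6) = δ₂' 2 7 1 n := by
  simpa using δ₂_eq_of_selfSimilar two_ne_zero (selfSimilar_f_one_seven.f_one_mul_f
    two_ne_zero (by norm_num) (by decide)) n

theorem δ₂_four_seven_one (n : ℕ) : δ₂ 4 7 1 (7 * n + 10) = δ₂' 4 7 1 n := by
  simpa using δ₂_eq_of_selfSimilar four_ne_zero (selfSimilar_f_one_seven.f_one_mul_f
    four_ne_zero (by norm_num) (by decide)) n

theorem δ₂_three_eleven_one (n : ℕ) : δ₂ 3 11 1 (11 * n + 20) = δ₂' 3 11 1 n := by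
  simpa using δ₂_eq_of_selfSimilar three_ne_zero (selfSimilar_f_one_eleven.f_one_mul_f
    three_ne_zero (by norm_num) (by decide)) n

theorem δ₂_four_eleven_one (n : ℕ) : δ₂ 4 11 1 (11 * n + 25) = δ₂' 4 11 1 n := by
  simpa using δ₂_eq_of_selfSimilar four_ne_zero (selfSimilar_f_one_eleven.f_one_mul_f
    four_ne_zero (by norm_num) (by decide)) n

/-! ### Isotropic case mod 5: powers of `f_1` -/

theorem f_one_ne_zero : f 1 ≠ 0 := f_ne_zero one_pos

theorem three_ne_zero_powerSeries : (3 : ℚ⟦X⟧) ≠ 0 := fun h => by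
  have := congrArg constantCoeff h
  rw [map_ofNat, map_zero] at this
  norm_num at this

theorem comp_five_mul (F G : ℚ⟦X⟧) :
    (comp 5 0 (F * G) = comp 5 0 F * comp 5 0 G + comp 5 1 F * comp 5 4 G +
      comp 5 2 F * comp 5 3 G + comp 5 3 F * comp 5 2 G + comp 5 4 F * comp 5 1 G) ∧
    (comp 5 1 (F * G) = comp 5 0 F * comp 5 1 G + comp 5 1 F * comp 5 0 G +
      comp 5 2 F * comp 5 4 G + comp 5 3 F * comp 5 3 G + comp 5 4 F * comp 5 2 G) ∧
    (comp 5 2 (F * G) = comp 5 0 F * comp 5 2 G + comp 5 1 F * comp 5 1 G +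
      comp 5 2 F * comp 5 0 G + comp 5 3 F * comp 5 4 G + comp 5 4 F * comp 5 3 G) ∧
    (comp 5 3 (F * G) = comp 5 0 F * comp 5 3 G + comp 5 1 F * comp 5 2 G +
      comp 5 2 F * comp 5 1 G + comp 5 3 F * comp 5 0 G + comp 5 4 F * comp 5 4 G) ∧
    (comp 5 4 (F * G) = comp 5 0 F * comp 5 4 G + comp 5 1 F * comp 5 3 G +
      comp 5 2 F * comp 5 2 G + comp 5 3 F * comp 5 1 G + comp 5 4 F * comp 5 0 G) :=
  ⟨(comp_mul (m := 5) 0 F G).trans (Fin.sum_univ_five _),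
    (comp_mul (m := 5) 1 F G).trans (Fin.sum_univ_five _),
    (comp_mul (m := 5) 2 F G).trans (Fin.sum_univ_five _),
    (comp_mul (m := 5) 3 F G).trans (Fin.sum_univ_five _),
    (comp_mul (m := 5) 4 F G).trans (Fin.sum_univ_five _)⟩

theorem comp_three_mul (F G : ℚ⟦X⟧) :
    (comp 3 0 (F * G) = comp 3 0 F * comp 3 0 G + comp 3 1 F * comp 3 2 G +
      comp 3 2 F * comp 3 1 G) ∧
    (comp 3 1 (F * G) = comp 3 0 F * comp 3 1 G + comp 3 1 F * comp 3 0 G +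
      comp 3 2 F * comp 3 2 G) ∧
    (comp 3 2 (F * G) = comp 3 0 F * comp 3 2 G + comp 3 1 F * comp 3 1 G +
      comp 3 2 F * comp 3 0 G) :=
  ⟨(comp_mul (m := 3) 0 F G).trans (Fin.sum_univ_three _),
    (comp_mul (m := 3) 1 F G).trans (Fin.sum_univ_three _),
    (comp_mul (m := 3) 2 F G).trans (Fin.sum_univ_three _)⟩

theorem comp_five_three_f_one : comp 5 3 (f 1) = 0 := squareSupport_f_one 5 3 (by decide)

theorem comp_five_four_f_one : comp 5 4 (f 1) = 0 := squareSupport_f_one 5 4 (by decide)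

theorem constantCoeff_comp_zero (m : ℕ) (F : ℚ⟦X⟧) :
    constantCoeff (comp m 0 F) = constantCoeff F := by
  rw [← coeff_zero_eq_constantCoeff_apply, coeff_comp]
  simp

theorem comp_zero_f_one_ne_zero (m : ℕ) : comp m 0 (f 1) ≠ 0 := fun h => by
  simpa [h, constantCoeff_f one_pos] using (constantCoeff_comp_zero m (f 1)).symm

/-- The relation between the components of the `5`-dissection of `f₁`. -/
theorem comp_five_f_one_relation :
    comp 5 0 (f 1) * comp 5 2 (f 1) + comp 5 1 (f 1) ^ 2 = 0 := by
  -- Class 2 is absent from `f_1^3` because `8 · 2 + 1 ≡ 2` is not a square mod 5. In terms of the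
  -- components of `f_1` this class is `3a(ac + b^2)`.
  have h := squareSupport_f_one_cube 5 2 (by decide)
  obtain ⟨h0, h1, h2, h3, h4⟩ := comp_five_mul (f 1) (f 1)
  rw [pow_succ, sq, (comp_five_mul _ _).2.2.1, h0, h1, h2, comp_five_three_f_one,
    comp_five_four_f_one] at h
  have h5 : (3 * comp 5 0 (f 1)) *
      (comp 5 0 (f 1) * comp 5 2 (f 1) + comp 5 1 (f 1) ^ 2) = 0 := by
    linear_combination h
  exact (mul_eq_zero.mp h5).resolve_left (mul_ne_zero
    three_ne_zero_powerSeries (comp_zero_f_one_ne_zero 5))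

theorem comp_five_one_f_one : comp 5 1 (f 1) =
    -(X * expand 5 (by norm_num) (expand 5 (by norm_num) (f 1))) := by
  have := selfSimilar_f_one_five
  rw [SelfSimilar, Nat.cast_one] at this
  rw [this]
  simp

/-- Class 2 of `f_1^2` is `2ac + b^2`, which equals `-b^2` by the relation `ac = -b^2`. -/
theorem δ_five_two (n : ℕ) : δ 5 2 (5 * n + 2) = -δ' 5 2 n := by
  have h : SelfSimilar 5 (by norm_num) 2 (-1) (f 1 ^ 2) := by
    rw [SelfSimilar, Nat.cast_ofNat, sq, (comp_five_mul _ _).2.2.1, comp_five_three_f_one,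
      comp_five_four_f_one]
    simp only [map_mul, map_neg, map_one]
    linear_combination 2 * comp_five_f_one_relation - (comp 5 1 (f 1) -
      (X * expand 5 (by norm_num) (expand 5 (by norm_num) (f 1)))) * comp_five_one_f_one
  simpa using δ_eq_of_selfSimilar h n

/-- In `(a + b + c)^8`, class 3 collects the weights 3, 8 and 13. Weights 3 and 13 are multiples of
`ac + b^2`. Weight 8 consists of the monomials `a^i b^(8-2i) c^i`, and `ac = -b^2` turns their
multinomial coefficients into `1 - 56 + 420 - 560 + 70 = -125`. -/
theorem comp_five_three_f_one_pow_eight :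
    comp 5 3 (f 1 ^ 8) = -125 * comp 5 1 (f 1) ^ 8 := by
  have h := comp_five_f_one_relation
  obtain ⟨h0, h1, h2, h3, h4⟩ := comp_five_mul (f 1) (f 1)
  obtain ⟨k0, k1, k2, k3, k4⟩ := comp_five_mul (f 1 * f 1) (f 1 * f 1)
  rw [show f 1 ^ 8 = (f 1 * f 1 * (f 1 * f 1)) * (f 1 * f 1 * (f 1 * f 1)) by ring,
    (comp_five_mul _ _).2.2.2.1, k0, k1, k2, k3, k4, h0, h1, h2, h3, h4, comp_five_three_f_one,
    comp_five_four_f_one]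
  generalize comp 5 0 (f 1) = a at *
  generalize comp 5 1 (f 1) = b at *
  generalize comp 5 2 (f 1) = c at *
  linear_combination (56 * a ^ 5 * b + 70 * a ^ 3 * c ^ 3 + 490 * a ^ 2 * b ^ 2 * c ^ 2 -
    70 * a * b ^ 4 * c + 126 * b ^ 6 + 56 * b * c ^ 5) * h

theorem δ_five_eight (n : ℕ) : δ 5 8 (5 * n + 8) = -125 * δ' 5 8 n := by
  have h : SelfSimilar 5 (by norm_num) 8 (-125) (f 1 ^ 8) := by
    rw [SelfSimilar, show ((8 : ℕ) : ZMod 5) = 3 by decide, comp_five_three_f_one_pow_eight,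
      comp_five_one_f_one]
    simp only [map_pow, map_neg, map_ofNat]
    ring
  exact δ_eq_of_selfSimilar h n

/-! ### Isotropic case mod 3: powers of `f_1 f_2` through `φ` and `ψ` -/

theorem ramanujanTheta_phi_sq_mul_psi :
    ramanujanTheta (-1) 1 1 ^ 2 * ramanujanTheta 1 3 1 = f 1 ^ 3 := by
  have h1 := ramanujanTheta_phi
  have h2 := ramanujanTheta_psi
  refine mul_right_cancel₀ (mul_ne_zero (pow_ne_zero 2 (f_ne_zero two_pos)) f_one_ne_zero) ?_
  linear_combination (ramanujanTheta (-1) 1 1 * f 2 * (ramanujanTheta 1 3 1 * f 1) +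
    f 1 ^ 2 * (ramanujanTheta 1 3 1 * f 1)) * h1 + f 1 ^ 4 * h2

theorem ramanujanTheta_phi_mul_psi :
    ramanujanTheta (-1) 1 1 * ramanujanTheta 1 3 1 = f 1 * f 2 := by
  have h1 := ramanujanTheta_phi
  have h2 := ramanujanTheta_psi
  refine mul_right_cancel₀ (mul_ne_zero (f_ne_zero two_pos) f_one_ne_zero) ?_
  linear_combination (ramanujanTheta 1 3 1 * f 1) * h1 + f 1 ^ 2 * h2

theorem exists_hasSum_phi : ∃ e : ℤ → ℕ, (∀ n : ℤ, (e n : ℤ) = n ^ 2) ∧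
    HasSum (fun n : ℤ => C ((-1 : ℚ) ^ n) * X ^ e n) (ramanujanTheta (-1) 1 1) := by
  obtain ⟨e, he, h⟩ := exists_hasSum_ramanujanTheta (ε := -1) (by norm_num) one_pos one_pos
  refine ⟨e, fun n => ?_, h⟩
  have := he n
  push_cast at this
  linarith

theorem selfSimilar_phi_three : SelfSimilar 3 (by norm_num) 0 1 (ramanujanTheta (-1) 1 1) := by
  obtain ⟨e, he, h⟩ := exists_hasSum_phi
  -- The exponents `n^2` are already squares, so `w = 0` and the self-similar class is 0.
  refine selfSimilar_of_hasSum (m := 3) h (D := 1) (s := 1) (w := 0) (n₀ := 0) (σ := 1)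
    (fun n => ?_) (by decide) (by decide) (by norm_num) (by norm_num) (by norm_num) fun k => ?_
  · rw [he]
    ring
  · rw [zpow_add_odd_mul (by norm_num) (by decide) (by norm_num)]
    simp

theorem comp_three_two_phi : comp 3 2 (ramanujanTheta (-1) 1 1) = 0 := by
  obtain ⟨e, he, h⟩ := exists_hasSum_phi
  refine comp_eq_zero_of_hasSum h fun n hn => ?_
  have h1 := congrArg (Int.cast : ℤ → ZMod 3) (he n)
  push_cast at h1
  rw [hn] at h1
  exact (by decide : ∀ x : ZMod 3, 2 ≠ x ^ 2) _ h1

theorem comp_three_two_psi : comp 3 2 (ramanujanTheta 1 3 1) = 0 :=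
  squareSupport_ramanujanTheta_three_one 3 2 (by decide)

theorem selfSimilar_psi_three : SelfSimilar 3 (by norm_num) 1 1 (ramanujanTheta 1 3 1) :=
  selfSimilar_ramanujanTheta_three_one (m := 3) (by decide) (by decide) (n₀ := -1) (σ := -1)
    (by norm_num) (by norm_num) (by norm_num)

theorem comp_three_one_phi_ne_zero : comp 3 1 (ramanujanTheta (-1) 1 1) ≠ 0 := by
  intro h
  have h1 : coeff 1 (ramanujanTheta (-1) 1 1) = 0 := by
    have := congrArg (coeff 1) h
    rwa [coeff_comp, if_pos (by simp), map_zero] at this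
  have h2 := congrArg (coeff 1) ramanujanTheta_phi
  have h3 : coeff 1 (f 2) = 0 := by
    rw [← mul_one 2, ← expand_f two_ne_zero one_ne_zero, coeff_expand_of_not_dvd _ _ _ (by norm_num)]
  have h4 : coeff 1 (f 1) = -1 := by
    have := X_pow_dvd_iff.mp (X_pow_dvd_qPochhammerInf_sub (α := (X : ℚ⟦X⟧)) dvd_rfl 2) 1 (by norm_num)
    rw [f, pow_one, ← sub_eq_zero]
    rw [map_sub] at this
    rw [← this]
    congr 1
    simp only [Finset.prod_range_succ, Finset.prod_range_zero]
    ring_nf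
    simp [coeff_X_pow, coeff_one, coeff_X]
  rw [sq, coeff_mul, coeff_mul] at h2
  simp [Finset.Nat.antidiagonal_succ, h1, h3, h4, constantCoeff_f one_pos] at h2
  norm_num at h2

/-- The relation between the components of the `3`-dissections of `φ(-q)` and `ψ(q)`. -/
theorem comp_three_phi_psi_relation :
    comp 3 1 (ramanujanTheta (-1) 1 1) * comp 3 0 (ramanujanTheta 1 3 1) +
      2 * comp 3 0 (ramanujanTheta (-1) 1 1) * comp 3 1 (ramanujanTheta 1 3 1) = 0 := by
  -- Class 2 mod 3 is absent from `f_1^3 = φ^2 ψ`. As `φ` and `ψ` live in classes 0 and 1, that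
  -- class is `φ₁(φ₁ψ₀ + 2φ₀ψ₁)`.
  have h := squareSupport_f_one_cube 3 2 (by decide)
  obtain ⟨h0, h1, h2⟩ := comp_three_mul (ramanujanTheta (-1) 1 1) (ramanujanTheta (-1) 1 1)
  rw [← ramanujanTheta_phi_sq_mul_psi, sq, (comp_three_mul _ _).2.2, h0, h1, h2,
    comp_three_two_phi, comp_three_two_psi] at h
  refine (mul_eq_zero.mp (?_ : comp 3 1 (ramanujanTheta (-1) 1 1) * _ = 0)).resolve_left
    comp_three_one_phi_ne_zero
  linear_combination h

/-- Since `φ₁ψ₀ = -2φ₀ψ₁`, class 1 of `φψ` is `φ₁ψ₀ + φ₀ψ₁ = -φ₀ψ₁`, a product of two self-similar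
components. The product of classes 0 and 2 is `(φ₀ψ₁)(φ₁ψ₀) = -2(φ₀ψ₁)^2`. -/
theorem comp_three_f_one_mul_f_two :
    comp 3 1 (f 1 * f 2) =
      -(X * expand 3 (by norm_num) (expand 3 (by norm_num) (f 1 * f 2))) ∧
    comp 3 0 (f 1 * f 2) * comp 3 2 (f 1 * f 2) + 2 * comp 3 1 (f 1 * f 2) ^ 2 = 0 := by
  have h := comp_three_phi_psi_relation
  have hφ := selfSimilar_phi_three
  have hψ := selfSimilar_psi_three
  rw [SelfSimilar] at hφ hψ
  obtain ⟨h0, h1, h2⟩ := comp_three_mul (ramanujanTheta (-1) 1 1) (ramanujanTheta 1 3 1)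
  rw [comp_three_two_phi, comp_three_two_psi] at h0 h1 h2
  rw [← ramanujanTheta_phi_mul_psi, h0, h1, h2]
  simp only [Nat.cast_zero, Nat.cast_one, map_one, pow_zero, one_mul, pow_one] at hφ hψ
  constructor
  · rw [map_mul, map_mul, ← hφ]
    linear_combination h - comp 3 0 (ramanujanTheta (-1) 1 1) * hψ
  · linear_combination (2 * comp 3 1 (ramanujanTheta (-1) 1 1) * comp 3 0 (ramanujanTheta 1 3 1) +
      comp 3 0 (ramanujanTheta (-1) 1 1) * comp 3 1 (ramanujanTheta 1 3 1)) * h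

theorem δ₂_two_three_one (n : ℕ) : δ₂ 2 3 1 (3 * n + 1) = -δ₂' 2 3 1 n := by
  have h : SelfSimilar 3 (by norm_num) 1 (-1) (f 1 ^ 1 * f 2 ^ 1) := by
    rw [SelfSimilar, pow_one, pow_one, Nat.cast_one, comp_three_f_one_mul_f_two.1]
    simp
  simpa using δ₂_eq_of_selfSimilar two_ne_zero h n

theorem δ₂_two_three_two (n : ℕ) : δ₂ 2 3 2 (3 * n + 2) = -3 * δ₂' 2 3 2 n := by
  have h : SelfSimilar 3 (by norm_num) 2 (-3) (f 1 ^ 2 * f 2 ^ 2) := by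
    obtain ⟨h1, h2⟩ := comp_three_f_one_mul_f_two
    rw [SelfSimilar, ← mul_pow, Nat.cast_ofNat, sq, (comp_three_mul _ _).2.2,
      map_mul (expand 3 _) (f 1 * f 2), map_mul (expand 3 _) (expand 3 _ (f 1 * f 2)), map_neg,
      map_ofNat]
    linear_combination 2 * h2 - 3 * (comp 3 1 (f 1 * f 2) - (X * expand 3 (by norm_num)
      (expand 3 (by norm_num) (f 1 * f 2)))) * h1
  exact δ₂_eq_of_selfSimilar two_ne_zero h n

/-- With `ac = -2b^2`, weights 2 and 8 of `(a + b + c)^5` cancel, and weight 5 is `b^5 + 20ab^3c +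
30a^2bc^2 = (1 - 40 + 120) b^5`. -/
theorem comp_three_two_f_one_mul_f_two_pow_five :
    comp 3 2 ((f 1 * f 2) ^ 5) = 81 * comp 3 1 (f 1 * f 2) ^ 5 := by
  have h := comp_three_f_one_mul_f_two.2
  obtain ⟨h0, h1, h2⟩ := comp_three_mul (f 1 * f 2) (f 1 * f 2)
  obtain ⟨k0, k1, k2⟩ := comp_three_mul (f 1 * f 2 * (f 1 * f 2)) (f 1 * f 2 * (f 1 * f 2))
  rw [show (f 1 * f 2) ^ 5 = (f 1 * f 2 * (f 1 * f 2) * (f 1 * f 2 * (f 1 * f 2))) * (f 1 * f 2)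
    by ring, (comp_three_mul _ (f 1 * f 2)).2.2, k0, k1, k2, h0, h1, h2]
  generalize comp 3 0 (f 1 * f 2) = a at *
  generalize comp 3 1 (f 1 * f 2) = b at *
  generalize comp 3 2 (f 1 * f 2) = c at *
  linear_combination (5 * a ^ 3 + 30 * a * b * c - 40 * b ^ 3 + 5 * c ^ 3) * h

theorem δ₂_two_three_five (n : ℕ) : δ₂ 2 3 5 (3 * n + 5) = -81 * δ₂' 2 3 5 n := by
  have h : SelfSimilar 3 (by norm_num) 5 (-81) (f 1 ^ 5 * f 2 ^ 5) := by
    rw [SelfSimilar, ← mul_pow, show ((5 : ℕ) : ZMod 3) = 2 by decide,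
      comp_three_two_f_one_mul_f_two_pow_five, comp_three_f_one_mul_f_two.1,
      map_pow (expand 3 _) (f 1 * f 2), map_pow (expand 3 _) (expand 3 _ (f 1 * f 2)), map_neg,
      map_ofNat]
    ring
  exact δ₂_eq_of_selfSimilar two_ne_zero h n

/-! ### Double theta sums and the 2-dissection of `f_3^3 / f_1` -/

theorem summable_monomial_mul {c c' : ℤ → ℚ} {e e' : ℤ → ℕ}
    (he : ∀ n, |n| ≤ e n) (he' : ∀ n, |n| ≤ e' n) :
    Summable fun p : ℤ × ℤ => C (c p.1 * c' p.2) * (X : ℚ⟦X⟧) ^ (e p.1 + e' p.2) := by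
  rw [PowerSeries.WithPiTopology.summable_iff_summable_coeff]
  intro d
  have hfin : (Function.support fun p : ℤ × ℤ =>
      coeff d (C (c p.1 * c' p.2) * (X : ℚ⟦X⟧) ^ (e p.1 + e' p.2))).Finite := by
    refine ((Finset.Icc (-d : ℤ) d) ×ˢ (Finset.Icc (-d : ℤ) d)).finite_toSet.subset fun p hp => ?_
    rw [Function.mem_support, coeff_C_mul, coeff_X_pow] at hp
    have hd : d = e p.1 + e' p.2 := by
      by_contra h0
      simp [h0] at hp
    have h1 := abs_le.mp (he p.1)
    have h2 := abs_le.mp (he' p.2)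
    simp only [Finset.coe_product, Set.mem_prod, Finset.mem_coe, Finset.mem_Icc]
    omega
  exact summable_of_hasFiniteSupport hfin

theorem hasSum_mul_of_le {c c' : ℤ → ℚ} {e e' : ℤ → ℕ} {F G : ℚ⟦X⟧}
    (he : ∀ n, |n| ≤ e n) (he' : ∀ n, |n| ≤ e' n)
    (hF : HasSum (fun n => C (c n) * X ^ e n) F) (hG : HasSum (fun n => C (c' n) * X ^ e' n) G) :
    HasSum (fun p : ℤ × ℤ => C (c p.1 * c' p.2) * X ^ (e p.1 + e' p.2)) (F * G) := by
  have hs := summable_monomial_mul (c := c) (c' := c') he he'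
  obtain ⟨u, hu⟩ : ∃ u : ℤ → ℚ⟦X⟧, u = fun n => C (c n) * X ^ e n := ⟨_, rfl⟩
  obtain ⟨v, hv⟩ : ∃ v : ℤ → ℚ⟦X⟧, v = fun n => C (c' n) * X ^ e' n := ⟨_, rfl⟩
  have h : (fun p : ℤ × ℤ => C (c p.1 * c' p.2) * (X : ℚ⟦X⟧) ^ (e p.1 + e' p.2)) =
      fun p : ℤ × ℤ => u p.1 * v p.2 := by
    funext p
    rw [map_mul, pow_add, hu, hv]
    ring
  rw [h] at hs ⊢
  rw [← hu] at hF
  rw [← hv] at hG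
  exact HasSum.mul hF hG hs

theorem abs_le_of_two_mul_eq {a b : ℕ} (ha : 0 < a) (hb : 0 < b) {e n : ℤ}
    (h : 2 * e = a * (n * (n + 1)) + b * (n * (n - 1))) : |n| ≤ e := by
  have h1 : (1 : ℤ) ≤ a := by exact_mod_cast ha
  have h2 : (1 : ℤ) ≤ b := by exact_mod_cast hb
  have h3 : 0 ≤ n * (n + 1) := by rcases le_or_gt 0 n with h | h <;> nlinarith
  have h4 : 0 ≤ n * (n - 1) := by rcases le_or_gt n 0 with h | h <;> nlinarith
  rw [abs_le]
  constructor <;> nlinarith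

theorem hasSum_expand {ι : Type*} {l : ℕ} (hl : l ≠ 0) {c : ι → ℚ} {e : ι → ℕ} {F : ℚ⟦X⟧}
    (hF : HasSum (fun n => C (c n) * X ^ e n) F) :
    HasSum (fun n => C (c n) * X ^ (l * e n)) (expand l hl F) := by
  have := hF.map (expand l hl) (continuous_expand hl)
  suffices h : (fun n => C (c n) * (X : ℚ⟦X⟧) ^ (l * e n)) = _ by rw [h]; exact this
  funext n
  simp [expand_C, pow_mul]

theorem HasSum.of_isCompl_comp {ι κ M : Type*} [AddCommMonoid M] [TopologicalSpace M]
    [ContinuousAdd M] {g : κ → M} {g₀ g₁ : ι → M} {j₀ j₁ : ι → κ} {a b : M}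
    (hj₀ : Function.Injective j₀) (hj₁ : Function.Injective j₁)
    (hj : IsCompl (Set.range j₀) (Set.range j₁)) (h₀ : HasSum g₀ a) (h₁ : HasSum g₁ b)
    (hg₀ : ∀ i, g (j₀ i) = g₀ i) (hg₁ : ∀ i, g (j₁ i) = g₁ i) : HasSum g (a + b) := by
  refine HasSum.add_isCompl hj (hj₀.hasSum_range_iff.mpr ?_) (hj₁.hasSum_range_iff.mpr ?_)
  · rwa [show g ∘ j₀ = g₀ from funext hg₀]
  · rwa [show g ∘ j₁ = g₁ from funext hg₁]

theorem neg_one_zpow_sub (a b : ℤ) : (-1 : ℚ) ^ (a - b) = (-1) ^ a * (-1) ^ b := by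
  rw [zpow_sub₀ (by norm_num)]
  rcases Int.even_or_odd b with h | h <;> simp [h.neg_one_zpow]
  rw [div_neg, div_one]

/-- Splitting a sum over `ℤ × ℤ` according to the parity of the sum of the coordinates. -/
theorem hasSum_of_hasSum_parity {M : Type*} [AddCommMonoid M] [TopologicalSpace M]
    [ContinuousAdd M] {g g₀ g₁ : ℤ × ℤ → M} {a b : M} (h₀ : HasSum g₀ a) (h₁ : HasSum g₁ b)
    (hg₀ : ∀ x y, g (x - y, x + y) = g₀ (x, y))
    (hg₁ : ∀ x y, g (y - x, -1 - x - y) = g₁ (x, y)) : HasSum g (a + b) := by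
  refine HasSum.of_isCompl_comp (j₀ := fun p : ℤ × ℤ => (p.1 - p.2, p.1 + p.2))
    (j₁ := fun p : ℤ × ℤ => (p.2 - p.1, -1 - p.1 - p.2)) ?_ ?_ ?_ h₀ h₁
    (fun _ => hg₀ _ _) (fun _ => hg₁ _ _)
  · rintro ⟨a, b⟩ ⟨c, d⟩ h
    simp only [Prod.mk.injEq] at h ⊢
    omega
  · rintro ⟨a, b⟩ ⟨c, d⟩ h
    simp only [Prod.mk.injEq] at h ⊢
    omega
  · rw [isCompl_iff, Set.disjoint_iff, codisjoint_iff]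
    constructor
    · rintro _ ⟨⟨⟨a, b⟩, rfl⟩, ⟨c, d⟩, h⟩
      simp only [Prod.mk.injEq] at h
      omega
    · refine Set.eq_univ_of_forall fun ⟨m, n⟩ => ?_
      rcases Int.even_or_odd' (m + n) with ⟨k, hk | hk⟩
      · refine Or.inl ⟨(k, n - k), ?_⟩
        simp only [Prod.mk.injEq]
        omega
      · refine Or.inr ⟨(-1 - k, m - 1 - k), ?_⟩
        simp only [Prod.mk.injEq]
        omega

theorem X_mul_C_mul_X_pow (r : ℚ) (n : ℕ) :
    (X : ℚ⟦X⟧) * (C r * X ^ n) = C r * X ^ (1 + n) := by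
  rw [pow_add, pow_one]
  ring

/-- The `2`-dissection of `φ(-q ^ 3) f(q, q ^ 5)`. -/
theorem expand_phi_mul_ramanujanTheta_five_one :
    expand 3 three_ne_zero (ramanujanTheta (-1) 1 1) * ramanujanTheta 1 5 1 =
      f 4 ^ 2 + X * expand 2 two_ne_zero (ramanujanTheta (-1) 5 1) ^ 2 := by
  obtain ⟨e₁, he₁, h₁⟩ := exists_hasSum_ramanujanTheta (ε := -1) (by norm_num) one_pos one_pos
  obtain ⟨e₂, he₂, h₂⟩ := exists_hasSum_ramanujanTheta (ε := 1) (mul_one 1) (a := 5) (b := 1)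
    (by norm_num) one_pos
  obtain ⟨e₃, he₃, h₃⟩ := exists_hasSum_ramanujanTheta (ε := -1) (by norm_num) two_pos one_pos
  obtain ⟨e₄, he₄, h₄⟩ := exists_hasSum_ramanujanTheta (ε := -1) (by norm_num) (a := 5) (b := 1)
    (by norm_num) one_pos
  have hb₁ (n : ℤ) : |n| ≤ (3 * e₁ n : ℕ) := by
    have := abs_le_of_two_mul_eq one_pos one_pos (he₁ n)
    omega
  have hb₂ (n : ℤ) : |n| ≤ e₂ n := abs_le_of_two_mul_eq (by norm_num) one_pos (he₂ n)
  have hb₃ (n : ℤ) : |n| ≤ (4 * e₃ n : ℕ) := by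
    have := abs_le_of_two_mul_eq two_pos one_pos (he₃ n)
    omega
  have hb₄ (n : ℤ) : |n| ≤ (2 * e₄ n : ℕ) := by
    have := abs_le_of_two_mul_eq (by norm_num) one_pos (he₄ n)
    omega
  push_cast at he₁ he₂ he₃ he₄
  have h₁' := hasSum_expand three_ne_zero h₁
  have h₃' := hasSum_expand four_ne_zero h₃
  have h₄' := hasSum_expand two_ne_zero h₄
  rw [← f_one_eq_ramanujanTheta, expand_f four_ne_zero one_ne_zero, mul_one] at h₃'
  have hL := hasSum_mul_of_le (c := fun n => (-1) ^ n) (c' := fun n => 1 ^ n)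
    (e := fun n => 3 * e₁ n) (e' := e₂) hb₁ hb₂ h₁' h₂
  have hE := hasSum_mul_of_le (c := fun n => (-1) ^ n) (c' := fun n => (-1) ^ n)
    (e := fun n => 4 * e₃ n) (e' := fun n => 4 * e₃ n) hb₃ hb₃ h₃' h₃'
  have hO := (hasSum_mul_of_le (c := fun n => (-1) ^ n) (c' := fun n => (-1) ^ n)
    (e := fun n => 2 * e₄ n) (e' := fun n => 2 * e₄ n) hb₄ hb₄ h₄' h₄').mul_left X
  rw [sq, sq]
  -- The exponent is `3m^2 + 3n^2 + 2n`. Pairs of even sum diagonalise it to four times pentagonal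
  -- numbers in `x` and `y`; the reflected parametrisation of odd sums gives `1 + 2(3x^2 + 2x) +
  -- 2(3y^2 + 2y)`.
  refine hL.unique (hasSum_of_hasSum_parity hE hO (fun x y => ?_) fun x y => ?_)
  · have h : 3 * e₁ (x - y) + e₂ (x + y) = 4 * e₃ x + 4 * e₃ y := by
      zify
      refine mul_left_cancel₀ (two_ne_zero (α := ℤ)) ?_
      linear_combination 3 * he₁ (x - y) + he₂ (x + y) - 4 * he₃ x - 4 * he₃ y
    simp only [h, neg_one_zpow_sub, one_zpow, mul_one]
  · have h : 3 * e₁ (y - x) + e₂ (-1 - x - y) = 1 + (2 * e₄ x + 2 * e₄ y) := by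
      zify
      refine mul_left_cancel₀ (two_ne_zero (α := ℤ)) ?_
      linear_combination 3 * he₁ (y - x) + he₂ (-1 - x - y) - 2 * he₄ x - 2 * he₄ y
    rw [X_mul_C_mul_X_pow]
    simp only [h, neg_one_zpow_sub, one_zpow, mul_one]
    rw [mul_comm ((-1 : ℚ) ^ y)]

/-- The `2`-dissection of `f₃ ^ 3 / f₁`, with denominators cleared. -/
theorem f_three_cube_mul_f_four : f 3 ^ 3 * f 4 =
    f 1 * (expand 2 two_ne_zero (ramanujanTheta 1 3 1) *
      expand 2 two_ne_zero (ramanujanTheta 1 2 1) * f 4 + X * f 12 ^ 3) := by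
  have h1 := congrArg (expand 3 three_ne_zero) ramanujanTheta_phi
  have h2 := ramanujanTheta_five_one
  have h3 := ramanujanTheta_neg_five_one
  have h4 := congrArg (expand 2 two_ne_zero) ramanujanTheta_neg_five_one
  have h5 := expand_phi_mul_ramanujanTheta_five_one
  have h6 := congrArg (expand 2 two_ne_zero) ramanujanTheta_psi
  have h7 := congrArg (expand 2 two_ne_zero) ramanujanTheta_two_one
  simp only [map_mul, map_pow, expand_f three_ne_zero one_ne_zero,
    expand_f three_ne_zero two_ne_zero, expand_f two_ne_zero one_ne_zero,
    expand_f two_ne_zero two_ne_zero, expand_f two_ne_zero three_ne_zero,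
    expand_f two_ne_zero (show 6 ≠ 0 by norm_num), Nat.reduceMul] at h1 h4 h6 h7
  have hf (n : ℕ) (hn : 0 < n) : f n ≠ 0 := f_ne_zero hn
  have hZ : ramanujanTheta (-1) 5 1 ≠ 0 := fun h => by
    rw [h, zero_mul, zero_mul] at h3
    exact mul_ne_zero (hf 1 (by norm_num)) (pow_ne_zero 2 (hf 6 (by norm_num))) h3.symm
  have f2 := hf 2 (by norm_num)
  have f12 := hf 12 (by norm_num)
  generalize expand 3 three_ne_zero (ramanujanTheta (-1) 1 1) = p at *
  generalize expand 2 two_ne_zero (ramanujanTheta (-1) 5 1) = w at *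
  generalize expand 2 two_ne_zero (ramanujanTheta 1 3 1) = s at *
  generalize expand 2 two_ne_zero (ramanujanTheta 1 2 1) = t at *
  generalize ramanujanTheta (-1) 5 1 = z at *
  generalize ramanujanTheta 1 5 1 = y at *
  -- Thus `f_3^3 / f_1` is `φ(-q^3) f(q, q^5)` times a series in `q^2`, and the known 2-dissection
  -- of that theta product applies.
  have hA : f 3 ^ 3 * f 2 ^ 2 * f 12 = f 1 * p * y * f 4 * f 6 ^ 2 := by
    refine mul_right_cancel₀ (mul_ne_zero hZ f12) ?_
    linear_combination f 3 ^ 2 * f 2 * f 12 ^ 2 * h3 - f 1 * p * f 4 * f 6 ^ 2 * h2 -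
      f 1 * p * f 6 ^ 3 * h4 - f 1 * f 6 ^ 2 * f 2 * f 12 ^ 2 * h1
  refine mul_right_cancel₀ (mul_ne_zero (pow_ne_zero 2 f2) f12) ?_
  linear_combination f 4 * hA + f 1 * f 4 ^ 2 * f 6 ^ 2 * h5 +
    f 1 * X * (w * f 4 * f 6 + f 2 * f 12 ^ 2) * h4 -
    f 1 * f 4 * (t * f 2 * f 12 * h6 + f 4 ^ 2 * h7)

/-! ### Self-similarity of `f_3^3 / f_1` mod 5 from a functional equation -/

theorem comp_X_mul {m : ℕ} (s : ZMod m) (F : ℚ⟦X⟧) : comp m (s + 1) (X * F) = X * comp m s F := by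
  ext n
  rw [coeff_comp]
  cases n with
  | zero => simp
  | succ n => simp [coeff_succ_X_mul, coeff_comp]

theorem eq_zero_of_eq_X_mul_expand {l : ℕ} (hl : l ≠ 0) {F : ℚ⟦X⟧} (h : F = X * expand l hl F) :
    F = 0 := by
  ext n
  induction n using Nat.strong_induction_on with
  | _ n ih =>
    rw [h]
    cases n with
    | zero => simp
    | succ n =>
      rw [coeff_succ_X_mul]
      by_cases hd : l ∣ n
      · obtain ⟨k, rfl⟩ := hd
        rw [coeff_expand_mul, ih k (Nat.lt_succ_of_le (Nat.le_mul_of_pos_left k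
          (Nat.pos_of_ne_zero hl))), map_zero, map_zero]
      · rw [coeff_expand_of_not_dvd _ _ _ hd, map_zero]

/-- Self-similarity of the solution of `F = G + q F(q ^ l)`. -/
theorem SelfSimilar.of_eq_add_X_mul_expand {m l r : ℕ} {hm : m ≠ 0} {c : ℚ} {F G : ℚ⟦X⟧}
    (hG : SelfSimilar m hm r c G) (hl : l ≠ 0) (hlm : Nat.Coprime l m)
    (hF : F = G + X * PowerSeries.expand l hl F) (hr : m ^ 2 + r = l * r + 1) :
    SelfSimilar m hm r c F := by
  have hr' : (r : ZMod m) = l * r + 1 := by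
    have := congrArg (Nat.cast : ℕ → ZMod m) hr
    push_cast at this
    rwa [CharP.cast_eq_zero, zero_pow two_ne_zero, zero_add] at this
  have h1 : comp m r F = comp m r G + X * PowerSeries.expand l hl (comp m r F) := by
    conv_lhs => rw [hF, map_add, hr', comp_X_mul, comp_expand_mul hl hlm, ← hr']
  have h2 : PowerSeries.expand m hm (PowerSeries.expand m hm F) =
      PowerSeries.expand m hm (PowerSeries.expand m hm G) + X ^ m ^ 2 *
        PowerSeries.expand l hl (PowerSeries.expand m hm (PowerSeries.expand m hm F)) := by
    conv_lhs => rw [hF]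
    simp only [map_add, map_mul, map_pow, expand_X, ← expand_mul, ← pow_mul]
    simp only [mul_comm, mul_left_comm, sq]
  rw [SelfSimilar] at hG ⊢
  -- Both sides solve the same inhomogeneous equation, the exponents matching by `m^2 + r = l r +
  -- 1`. Their difference satisfies the homogeneous one, whose only solution is 0.
  refine sub_eq_zero.mp (eq_zero_of_eq_X_mul_expand hl ?_)
  have h3 : (X : ℚ⟦X⟧) ^ r * X ^ m ^ 2 = X * (X ^ l) ^ r := by
    rw [← pow_add, ← pow_mul, ← pow_succ', add_comm r, hr]
  rw [map_sub, map_mul, map_mul, map_pow, expand_C, expand_X]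
  linear_combination h1 + hG - C c * X ^ r * h2 - C c *
    PowerSeries.expand l hl (PowerSeries.expand m hm (PowerSeries.expand m hm F)) * h3

/-- Since `f_12^3 / f_4 = F(q^4)`, the 2-dissection reads `F = ψ(q^2) f(q^2, q^4) + q F(q^4)`. The
inhomogeneous term is an anisotropic product with `r = 6 + 2`, and `25 + 8 = 4 · 8 + 1`. -/
theorem exists_mul_f_one_eq_f_three_cube :
    ∃ F : ℚ⟦X⟧, F * f 1 = f 3 ^ 3 ∧ SelfSimilar 5 (by norm_num) 8 1 F := by
  have hF : f 3 ^ 3 * (f 1)⁻¹ * f 1 = f 3 ^ 3 := by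
    rw [mul_assoc, PowerSeries.inv_mul_cancel _ (by simp [constantCoeff_f one_pos]), mul_one]
  generalize f 3 ^ 3 * (f 1)⁻¹ = F at hF
  refine ⟨F, hF, ?_⟩
  have hF4 := congrArg (expand 4 four_ne_zero) hF
  rw [map_mul, map_pow, expand_f four_ne_zero one_ne_zero, expand_f four_ne_zero three_ne_zero]
    at hF4
  have h := f_three_cube_mul_f_four
  have hψ := (selfSimilar_ramanujanTheta_three_one (m := 5) (by decide) (by decide) (n₀ := 1)
    (σ := 1) (by norm_num) (by norm_num) (r := 3) (by norm_num)).expand two_ne_zero (by norm_num)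
  have hT := (selfSimilar_ramanujanTheta_two_one (m := 5) (by decide) (by decide) (by decide)
    (mul_one 1) (n₀ := -1) (σ := -1) (by norm_num) (by norm_num) (r := 1)
    (by norm_num)).expand two_ne_zero (by norm_num)
  have hG := hψ.mul_of_anisotropic hT
    ((squareSupport_ramanujanTheta_three_one 5).expand two_ne_zero (by norm_num))
    ((squareSupport_ramanujanTheta_two_one 5 (mul_one 1)).expand two_ne_zero (by norm_num))
    (by decide)
  rw [one_zpow, one_mul] at hG
  refine hG.of_eq_add_X_mul_expand four_ne_zero (by norm_num) ?_ (by norm_num)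
  refine mul_right_cancel₀ (mul_ne_zero (f_ne_zero (n := 4) (by norm_num)) f_one_ne_zero) ?_
  linear_combination f 4 * hF + h - X * f 1 * hF4

/-! ### Isotropic case mod 5: `f_1^2 f_3^2` -/

theorem comp_five_expand_three (F : ℚ⟦X⟧) :
    comp 5 0 (expand 3 three_ne_zero F) = expand 3 three_ne_zero (comp 5 0 F) ∧
    comp 5 3 (expand 3 three_ne_zero F) = expand 3 three_ne_zero (comp 5 1 F) ∧
    comp 5 1 (expand 3 three_ne_zero F) = expand 3 three_ne_zero (comp 5 2 F) ∧
    comp 5 4 (expand 3 three_ne_zero F) = expand 3 three_ne_zero (comp 5 3 F) ∧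
    comp 5 2 (expand 3 three_ne_zero F) = expand 3 three_ne_zero (comp 5 4 F) :=
  ⟨comp_expand_mul (m := 5) three_ne_zero (by norm_num) 0 F,
    comp_expand_mul (m := 5) three_ne_zero (by norm_num) 1 F,
    comp_expand_mul (m := 5) three_ne_zero (by norm_num) 2 F,
    comp_expand_mul (m := 5) three_ne_zero (by norm_num) 3 F,
    comp_expand_mul (m := 5) three_ne_zero (by norm_num) 4 F⟩

/-- Elimination of the remaining components of a quotient `F` of the cube of a series with
components `x`, `y`, `z` in the classes `0`, `3`, `1` by a series with components `a`, `b`, `c` in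
the classes `0`, `1`, `2`. -/
theorem mul_eq_zero_of_quotient_components {R : Type*} [CommRing R]
    {a b c x y z c₀ c₁ c₂ c₃ c₄ : R}
    (h : a * c + b ^ 2 = 0) (h' : x * z + y ^ 2 = 0) (hb : b * c₃ = y ^ 3)
    (e₀ : a * c₀ + b * c₄ + c * c₃ = x ^ 3 + 3 * y * z ^ 2)
    (e₁ : a * c₁ + b * c₀ + c * c₄ = 3 * x ^ 2 * z + 3 * x * y ^ 2)
    (e₂ : a * c₂ + b * c₁ + c * c₀ = 3 * x * z ^ 2 + 3 * y ^ 2 * z)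
    (e₃ : a * c₃ + b * c₂ + c * c₁ = 3 * x ^ 2 * y + z ^ 3)
    (e₄ : a * c₄ + b * c₃ + c * c₂ = 6 * x * y * z + y ^ 3) :
    (a ^ 2 * x * y + a * b * z ^ 2 + b * c * x ^ 2 + c ^ 2 * y * z + 3 * b ^ 2 * y ^ 2) *
      (3 * a ^ 2 * b * x + c ^ 3 * x - 10 * b ^ 3 * y + a ^ 3 * z + 3 * b * c ^ 2 * z) = 0 := by
  have e₁' : a * c₁ + b * c₀ + c * c₄ = 0 := by linear_combination e₁ + 3 * x * h'
  have e₂' : a * c₂ + b * c₁ + c * c₀ = 0 := by linear_combination e₂ + 3 * z * h'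
  have e₄' : a * c₄ + b * c₃ + c * c₂ = -5 * y ^ 3 := by linear_combination e₄ + 6 * y * h'
  -- Cramer's rule for `c₃`. The left factor is the circulant determinant `a^5 + b^5 + c^5 - 5ab^3c
  -- + 5a^2bc^2` of multiplication by `a + b + c`, reduced by `ac = -b^2`. Comparison with `b c₃ =
  -- y^3` then leaves a polynomial that factors.
  have hN : (a ^ 5 + 11 * b ^ 5 + c ^ 5) * c₃ =
      (x ^ 3 + 3 * y * z ^ 2) * (-3 * a * b ^ 3 + c ^ 4) +
      (3 * x ^ 2 * y + z ^ 3) * (a ^ 4 - 3 * b ^ 3 * c) - 25 * y ^ 3 * b ^ 4 := by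
    linear_combination (-3 * a * b ^ 3 + c ^ 4) * e₀ + (2 * a ^ 2 * b ^ 2 - b * c ^ 3) * e₁' +
      (-a ^ 3 * b + 2 * b ^ 2 * c ^ 2) * e₂' + (a ^ 4 - 3 * b ^ 3 * c) * e₃ + 5 * b ^ 4 * e₄' -
      ((-a ^ 2 * b + c ^ 3) * c₀ + (a ^ 3 - b * c ^ 2) * c₁ + 2 * b ^ 2 * c * c₂ -
        6 * b ^ 3 * c₃ + 2 * a * b ^ 2 * c₄) * h
  linear_combination (a ^ 5 + 11 * b ^ 5 + c ^ 5) * hb - b * hN -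
    (-a ^ 2 * b * x ^ 2 * z - a ^ 2 * c * y * z ^ 2 - 3 * a * b ^ 2 * x ^ 3 +
      a * b ^ 2 * y * z ^ 2 - 6 * a * b * c * x * y * z - a * c ^ 2 * x ^ 2 * y +
      6 * b ^ 3 * x * y * z + b ^ 2 * c * x ^ 2 * y - 3 * b ^ 2 * c * z ^ 3 -
      b * c ^ 2 * x * z ^ 2) * h -
    (-a ^ 5 * y - 3 * a ^ 3 * b ^ 2 * z + a ^ 2 * b ^ 3 * x - 6 * b ^ 5 * y +
      b ^ 3 * c ^ 2 * z - 3 * b ^ 2 * c ^ 3 * x - c ^ 5 * y) * h'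

/-- The term `3a^2bx` has lowest coefficient `-3` at `q`, while all other terms are divisible by
`q^2`. -/
theorem quotient_component_factor_ne_zero {a b c x y z : ℚ⟦X⟧} (ha : constantCoeff a = 1)
    (hx : constantCoeff x = 1) (hb : ∃ b', b = X * b' ∧ constantCoeff b' = -1) (hc : X ∣ c)
    (hy : X ^ 2 ∣ y) (hz : X ^ 2 ∣ z) :
    3 * a ^ 2 * b * x + c ^ 3 * x - 10 * b ^ 3 * y + a ^ 3 * z + 3 * b * c ^ 2 * z ≠ 0 := by
  obtain ⟨b', rfl, hb'⟩ := hb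
  obtain ⟨c', rfl⟩ := hc
  obtain ⟨y', rfl⟩ := hy
  obtain ⟨z', rfl⟩ := hz
  intro h
  have h1 : (X : ℚ⟦X⟧) * (3 * a ^ 2 * b' * x + X * (X * c' ^ 3 * x - 10 * b' ^ 3 * X ^ 3 * y' +
      a ^ 3 * z' + 3 * X ^ 3 * b' * c' ^ 2 * z')) = 0 := by
    linear_combination h
  have h2 := congrArg constantCoeff ((mul_eq_zero.mp h1).resolve_left X_ne_zero)
  simp [ha, hx, hb'] at h2
  rw [map_ofNat] at h2
  norm_num at h2

theorem comp_five_f_three :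
    comp 5 0 (f 3) * comp 5 1 (f 3) + comp 5 3 (f 3) ^ 2 = 0 ∧
    comp 5 2 (f 3) = 0 ∧
    comp 5 3 (f 3) =
      -(X ^ 3 * expand 5 (by norm_num) (expand 5 (by norm_num) (f 3))) ∧
    comp 5 4 (f 3) = 0 := by
  have h := congrArg (expand 3 three_ne_zero) comp_five_f_one_relation
  obtain ⟨x0, x3, x1, x4, x2⟩ := comp_five_expand_three (f 1)
  have hS := selfSimilar_f_one_five.expand three_ne_zero (by norm_num)
  rw [SelfSimilar, mul_one, Nat.cast_ofNat] at hS
  rw [expand_f three_ne_zero one_ne_zero, mul_one] at x0 x1 x2 x3 x4 hS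
  rw [map_add, map_mul, map_pow, ← x0, ← x1, ← x3, map_zero] at h
  refine ⟨h, ?_, ?_, ?_⟩
  · rw [x2, comp_five_four_f_one, map_zero]
  · rw [hS]
    simp
  · rw [x4, comp_five_three_f_one, map_zero]

theorem comp_five_f_one_f_three_relation :
    comp 5 0 (f 1) ^ 2 * comp 5 0 (f 3) * comp 5 3 (f 3) +
      comp 5 0 (f 1) * comp 5 1 (f 1) * comp 5 1 (f 3) ^ 2 +
      comp 5 1 (f 1) * comp 5 2 (f 1) * comp 5 0 (f 3) ^ 2 +
      comp 5 2 (f 1) ^ 2 * comp 5 3 (f 3) * comp 5 1 (f 3) +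
      3 * comp 5 1 (f 1) ^ 2 * comp 5 3 (f 3) ^ 2 = 0 := by
  obtain ⟨F, hF, hS⟩ := exists_mul_f_one_eq_f_three_cube
  have h := comp_five_f_one_relation
  have hb := comp_five_one_f_one
  have hc0 : constantCoeff (comp 5 2 (f 1)) = 0 := by
    rw [← coeff_zero_eq_constantCoeff_apply, coeff_comp, if_neg (by decide)]
  obtain ⟨h', x2, hy, x4⟩ := comp_five_f_three
  have hx0 : constantCoeff (comp 5 0 (f 3)) = 1 := by
    rw [constantCoeff_comp_zero, constantCoeff_f three_pos]
  have ha0 : constantCoeff (comp 5 0 (f 1)) = 1 := by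
    rw [constantCoeff_comp_zero, constantCoeff_f one_pos]
  have hz : X ^ 3 ∣ comp 5 1 (f 3) := by
    obtain ⟨c', hc'⟩ := X_dvd_iff.mpr hc0
    rw [← mul_one 3, ← expand_f three_ne_zero one_ne_zero, (comp_five_expand_three _).2.2.1, hc',
      map_mul, expand_X]
    exact dvd_mul_right _ _
  have hF' := congrArg (fun G => expand 5 (by norm_num) (expand 5 (by norm_num) G)) hF
  simp only [map_mul, map_pow] at hF'
  rw [SelfSimilar, map_one, one_mul] at hS
  -- All three components are self-similar, so this is `F f_1 = f_3^3` at `q^25`, multiplied by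
  -- `-q^9`.
  have hbc : comp 5 1 (f 1) * comp 5 3 F = comp 5 3 (f 3) ^ 3 := by
    rw [show (3 : ZMod 5) = ((8 : ℕ) : ZMod 5) by decide, hS,
      show ((8 : ℕ) : ZMod 5) = 3 by decide, hb, hy]
    linear_combination -X ^ 9 * hF'
  have hy3 : X ^ 3 ∣ comp 5 3 (f 3) := by
    rw [hy, dvd_neg]
    exact dvd_mul_right _ _
  have h23 : (X : ℚ⟦X⟧) ^ 2 ∣ X ^ 3 := pow_dvd_pow _ (by norm_num)
  have hQ := quotient_component_factor_ne_zero ha0 hx0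
    ⟨_, hb.trans (mul_neg _ _).symm, by simp [constantCoeff_f one_pos]⟩ (X_dvd_iff.mpr hc0)
    (h23.trans hy3) (h23.trans hz)
  obtain ⟨d0, d1, d2, d3, d4⟩ := comp_five_mul (f 3) (f 3)
  obtain ⟨k0, k1, k2, k3, k4⟩ := comp_five_mul (f 3 * f 3) (f 3)
  obtain ⟨l0, l1, l2, l3, l4⟩ := comp_five_mul F (f 1)
  rw [hF, pow_succ, sq, comp_five_three_f_one, comp_five_four_f_one] at l0 l1 l2 l3 l4
  rw [d0, d1, d2, d3, d4, x2, x4] at k0 k1 k2 k3 k4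
  refine (mul_eq_zero.mp (mul_eq_zero_of_quotient_components h h' hbc (c₀ := comp 5 0 F)
    (c₁ := comp 5 1 F) (c₂ := comp 5 2 F) (c₄ := comp 5 4 F) ?_ ?_ ?_ ?_ ?_)).resolve_right hQ
  · linear_combination k0 - l0
  · linear_combination k1 - l1
  · linear_combination k2 - l2
  · linear_combination k3 - l3
  · linear_combination k4 - l4

/-- Let `a, b, c` be classes 0, 1, 2 of `f_1` and `x, y, z` classes 0, 3, 1 of `f_3`. In class 3 of
`f_1^2 f_3^2`, the mixed relation contributes `-6b^2y^2`, and `(2ac + b^2)(2xz + y^2) = b^2y^2`; the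
total is `-5b^2y^2`. -/
theorem δ₂_three_five_two (n : ℕ) : δ₂ 3 5 2 (5 * n + 8) = -5 * δ₂' 3 5 2 n := by
  have h : SelfSimilar 5 (by norm_num) 8 (-5) (f 1 ^ 2 * f 3 ^ 2) := by
    have h := comp_five_f_one_relation
    have hK := comp_five_f_one_f_three_relation
    have hb := comp_five_one_f_one
    obtain ⟨h', x2, hy, x4⟩ := comp_five_f_three
    obtain ⟨d0, d1, d2, d3, d4⟩ := comp_five_mul (f 1) (f 1)
    obtain ⟨k0, k1, k2, k3, k4⟩ := comp_five_mul (f 3) (f 3)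
    rw [comp_five_three_f_one, comp_five_four_f_one] at d0 d1 d2 d3 d4
    rw [x2, x4] at k0 k1 k2 k3 k4
    have hbb := congrArg₂ (fun F G : ℚ⟦X⟧ => -5 * F ^ 2 * G ^ 2) hb hy
    rw [SelfSimilar, sq, sq, show ((8 : ℕ) : ZMod 5) = 3 by decide,
      (comp_five_mul _ _).2.2.2.1, d0, d1, d2, d3, d4, k0, k1, k2, k3, k4]
    simp only [map_mul, map_neg, map_ofNat]
    linear_combination 2 * hK + hbb + 2 * (2 * comp 5 0 (f 3) * comp 5 1 (f 3) +
      comp 5 3 (f 3) ^ 2) * h - 2 * comp 5 1 (f 1) ^ 2 * h'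
  exact δ₂_eq_of_selfSimilar three_ne_zero h n

end MatchingCoeff

theorem theorem1p2 :
    (∀ n : ℕ, MatchingCoeff.δ 3 3 (3 * n + 1) = -3 * MatchingCoeff.δ' 3 3 n) ∧
    (∀ n : ℕ, MatchingCoeff.δ 3 6 (3 * n + 2) = 9 * MatchingCoeff.δ' 3 6 n) ∧
    (∀ n : ℕ, MatchingCoeff.δ 5 2 (5 * n + 2) = -MatchingCoeff.δ' 5 2 n) ∧
    (∀ n : ℕ, MatchingCoeff.δ 5 3 (5 * n + 3) = 5 * MatchingCoeff.δ' 5 3 n) ∧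
    (∀ n : ℕ, MatchingCoeff.δ 5 4 (5 * n + 4) = -5 * MatchingCoeff.δ' 5 4 n) ∧
    (∀ n : ℕ, MatchingCoeff.δ 5 8 (5 * n + 8) = -125 * MatchingCoeff.δ' 5 8 n) ∧
    (∀ n : ℕ, MatchingCoeff.δ 7 2 (7 * n + 4) = MatchingCoeff.δ' 7 2 n) ∧
    (∀ n : ℕ, MatchingCoeff.δ 7 3 (7 * n + 6) = -7 * MatchingCoeff.δ' 7 3 n) ∧
    (∀ n : ℕ, MatchingCoeff.δ 7 6 (7 * n + 12) = 49 * MatchingCoeff.δ' 7 6 n) ∧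
    (∀ n : ℕ, MatchingCoeff.δ 11 2 (11 * n + 10) = MatchingCoeff.δ' 11 2 n) ∧
    (∀ n : ℕ, MatchingCoeff.δ₂ 2 3 1 (3 * n + 1) = -MatchingCoeff.δ₂' 2 3 1 n) ∧
    (∀ n : ℕ, MatchingCoeff.δ₂ 2 3 2 (3 * n + 2) = -3 * MatchingCoeff.δ₂' 2 3 2 n) ∧
    (∀ n : ℕ, MatchingCoeff.δ₂ 2 3 5 (3 * n + 5) = -81 * MatchingCoeff.δ₂' 2 3 5 n) ∧
    (∀ n : ℕ, MatchingCoeff.δ₂ 2 5 1 (5 * n + 3) = MatchingCoeff.δ₂' 2 5 1 n) ∧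
    (∀ n : ℕ, MatchingCoeff.δ₂ 2 5 3 (5 * n + 9) = 25 * MatchingCoeff.δ₂' 2 5 3 n) ∧
    (∀ n : ℕ, MatchingCoeff.δ₂ 3 5 1 (5 * n + 4) = MatchingCoeff.δ₂' 3 5 1 n) ∧
    (∀ n : ℕ, MatchingCoeff.δ₂ 3 5 2 (5 * n + 8) = -5 * MatchingCoeff.δ₂' 3 5 2 n) ∧
    (∀ n : ℕ, MatchingCoeff.δ₂ 3 5 3 (5 * n + 12) = 25 * MatchingCoeff.δ₂' 3 5 3 n) ∧
    (∀ n : ℕ, MatchingCoeff.δ₂ 2 7 1 (7 * n + 6) = MatchingCoeff.δ₂' 2 7 1 n) ∧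
    (∀ n : ℕ, MatchingCoeff.δ₂ 4 7 1 (7 * n + 10) = MatchingCoeff.δ₂' 4 7 1 n) ∧
    (∀ n : ℕ, MatchingCoeff.δ₂ 3 11 1 (11 * n + 20) = MatchingCoeff.δ₂' 3 11 1 n) ∧
    (∀ n : ℕ, MatchingCoeff.δ₂ 4 11 1 (11 * n + 25) = MatchingCoeff.δ₂' 4 11 1 n) :=
  open MatchingCoeff in
  ⟨δ_three_three, δ_three_six, δ_five_two, δ_five_three, δ_five_four, δ_five_eight, δ_seven_two,
    δ_seven_three, δ_seven_six, δ_eleven_two, δ₂_two_three_one, δ₂_two_three_two,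
    δ₂_two_three_five, δ₂_two_five_one, δ₂_two_five_three, δ₂_three_five_one, δ₂_three_five_two,
    δ₂_three_five_three, δ₂_two_seven_one, δ₂_four_seven_one, δ₂_three_eleven_one,
    δ₂_four_eleven_one⟩
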